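/- Let $1\le s\le p$ be integers, and let $\mathbf{x}^\star\in\mathbb{R}^p$ be a nonzero $s$-sparse vector, i.e. a vector with at most $s$ nonzero entries. Let $\mathcal{A}\subset\mathbb{R}^p$ be the set of one-sparse vectors of unit Euclidean norm, let $\|\mathbf{x}\|_{\mathcal{A}}=\inf\{t>0:\mathbf{x}\in t\,\mathrm{conv}(\mathcal{A})\}$ be the induced atomic norm (the $\ell_1$ norm), and let $$T_{\mathcal{A}}(\mathbf{x}^\star)=\mathrm{cone}\{\mathbf{z}-\mathbf{x}^\star:\|\mathbf{z}\|_{\mathcal{A}}\le\|\mathbf{x}^\star\|_{\mathcal{A}}\}$$ be the tangent cone at $\mathbf{x}^\star$ (the conic hull, i.e. the smallest convex cone containing these vectors). Let $\Omega=T_{\mathcal{A}}(\mathbf{x}^\star)\cap\mathbb{S}^{p-1}$ be its spherical part, and let $w(\Omega)=\mathbb{E}_{\mathbf{g}}\big[\sup_{\mathbf{z}\in\Omega}\mathbf{g}^T\mathbf{z}\big]$, with $\mathbf{g}\sim\mathcal{N}(0,I_p)$, be its Gaussian width. Then this supremum is an integrable function of $\mathbf{g}$, and $$w(\Omega)^2\le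 2s\log\left(\tfrac{p}{s}\right)+\tfrac54 s .$$ Consequently $2s\log(p/s)+\tfrac54 s+1$ Gaussian measurements suffice to recover $\mathbf{x}^\star$ by $\ell_1$ minimization with high probability, in the following sense. Let $\lambda_n$ denote the expected Euclidean length of a standard Gaussian vector in $\mathbb{R}^n$. For every integer $n\ge 2s\log(p/s)+\tfrac54 s+1$ we have $w(\Omega)<\lambda_n$, and if $\Phi$ is a random $n\times p$ matrix with independent $\mathcal{N}(0,1/n)$ entries, then with probability at least $$1-\exp\left(-\tfrac12\left[\lambda_n-w(\Omega)\right]^2\right)$$ the vector $\mathbf{x}^\star$ is the unique optimal solution of the problem of minimizing $\|\mathbf{z}\|_1$ over $\mathbf{z}\in\mathbb{R}^p$ subject to $\Phi\mathbf{z}=\Phi\mathbf{x}^\star$. -/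

import Mathlib

open MeasureTheory ProbabilityTheory
open scoped NNReal

/-- `x ∈ ℝ^p` is `s`-sparse: it has at most `s` nonzero coordinates. -/
def IsSparse {p : ℕ} (s : ℕ) (x : EuclideanSpace ℝ (Fin p)) : Prop :=
  {i : Fin p | x i ≠ 0}.ncard ≤ s

/-- The atoms: the one-sparse vectors of unit Euclidean norm in `ℝ^p`. -/
def sparseAtoms (p : ℕ) : Set (EuclideanSpace ℝ (Fin p)) :=
  {a | IsSparse 1 a ∧ ‖a‖ = 1}

/-- The atomic norm of an atomic set `A`, i.e. the gauge
`‖x‖_A = inf {t > 0 : x ∈ t conv(A)}` of its convex hull. -/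
noncomputable def atomicNorm {p : ℕ} (A : Set (EuclideanSpace ℝ (Fin p)))
    (x : EuclideanSpace ℝ (Fin p)) : ℝ :=
  gauge (convexHull ℝ A) x

/-- The tangent cone `T_A(x) = cone {z - x : ‖z‖_A ≤ ‖x‖_A}` at `x` with respect to the scaled
unit ball of the atomic norm (as a set). It contains `0`, because `z = x` is allowed. -/
noncomputable def atomicTangentCone {p : ℕ} (A : Set (EuclideanSpace ℝ (Fin p)))
    (x : EuclideanSpace ℝ (Fin p)) : Set (EuclideanSpace ℝ (Fin p)) :=
  (ConvexCone.hull ℝ {d | ∃ z, atomicNorm A z ≤ atomicNorm A x ∧ d = z - x} :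
    ConvexCone ℝ (EuclideanSpace ℝ (Fin p)))

/-- The spherical part `T_A(x) ∩ S^{p-1}` of the tangent cone. -/
noncomputable def sphericalTangent {p : ℕ} (A : Set (EuclideanSpace ℝ (Fin p)))
    (x : EuclideanSpace ℝ (Fin p)) : Set (EuclideanSpace ℝ (Fin p)) :=
  atomicTangentCone A x ∩ Metric.sphere 0 1

/-- `sup_{z ∈ S} gᵀ z`. -/
noncomputable def supInner {p : ℕ} (S : Set (EuclideanSpace ℝ (Fin p)))
    (g : EuclideanSpace ℝ (Fin p)) : ℝ :=
  sSup ((fun z => inner ℝ g z) '' S)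

/-- The Gaussian width `w(S) = E_g [sup_{z ∈ S} gᵀ z]`, `g ∼ N(0, I)`. -/
noncomputable def gaussianWidth {p : ℕ} (S : Set (EuclideanSpace ℝ (Fin p))) : ℝ :=
  ∫ g, supInner S g ∂(stdGaussian (EuclideanSpace ℝ (Fin p)))

/-- `λ_k`, the expected Euclidean length of a standard Gaussian vector in `ℝ^k`. -/
noncomputable def expectedGaussianLength (k : ℕ) : ℝ :=
  ∫ g, ‖g‖ ∂(stdGaussian (EuclideanSpace ℝ (Fin k)))

/-- The `ℓ₁` norm on `ℝ^p`. -/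
def l1Norm {p : ℕ} (x : EuclideanSpace ℝ (Fin p)) : ℝ := ∑ i, |x i|

/-- `xhat` is the unique optimal solution of
`minimize f(z) subject to y = Φ z`. -/
def IsUniqueOptimum {n p : ℕ} (f : EuclideanSpace ℝ (Fin p) → ℝ)
    (Φ : Matrix (Fin n) (Fin p) ℝ) (y : Fin n → ℝ) (xhat : EuclideanSpace ℝ (Fin p)) : Prop :=
  y = Φ.mulVec xhat.ofLp ∧
    ∀ z : EuclideanSpace ℝ (Fin p), y = Φ.mulVec z.ofLp → z ≠ xhat → f xhat < f z

/-- `Φ` is a random `n × p` matrix whose entries are independent centred Gaussians of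
variance `1 / n`. -/
structure IsGaussianMap {Ω : Type*} [MeasurableSpace Ω] (P : Measure Ω) {n p : ℕ}
    (Φ : Ω → Matrix (Fin n) (Fin p) ℝ) : Prop where
  hasLaw : ∀ i j, HasLaw (fun ω => Φ ω i j) (gaussianReal 0 (1 / (n : ℝ≥0))) P
  indep : iIndepFun (fun (ij : Fin n × Fin p) ω => Φ ω ij.1 ij.2) P

/-!
The proof has a probabilistic half, Gordon's escape through a mesh with sharp constants, and a
convex-geometric half, the width of the tangent cone of the `ℓ₁` norm.

*Recovery from small width.* The atomic norm is the `ℓ₁` norm (`atomicNorm_sparseAtoms`), so if `x`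
is not the unique minimizer then `ker Φ` meets the spherical tangent set
(`exists_mem_sphericalTangent_of_not_isUniqueOptimum`). It remains to bound the probability that a
Gaussian kernel meets a subset `S` of the sphere with `w(S) < λₙ`
(`measureReal_exists_matrixEval_eq_zero_le`). For a finite set of unit vectors `z`, the minimum of
`‖G z‖` is replaced by a smooth soft minimum `F(G)`, a `1`-Lipschitz function.

* Gordon's inequality `𝔼 F ≥ λₙ - w(S) - o(1)` comes from interpolating between the process `G z` and
  the decoupled process `(g, ⟪h, z⟫)`. By Gaussian integration by parts the derivative along the
  interpolation is a difference of traces of the second derivative of the soft minimum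
  (`integral_stdGaussian_le_of_trace_le`), and that difference is
  `β ∑ wₜ wₜ' (1 - ⟪∇Nₜ, ∇Nₜ'⟫) (1 - ⟪zₜ, zₜ'⟫) ≥ 0`, where `Nₜ` is the smoothed norm
  (`sum_decoupledProcess_le_sum_bilinearProcess`).
* The lower tail `ℙ(F ≤ 𝔼 F - r) ≤ exp(-r² / 2)` comes from the covariance inequality
  `Cov(F, H) ≤ 𝔼 K` whenever `⟪∇H(x), ∇F(y)⟫ ≤ K(x)`
  (`integral_mul_sub_le_of_inner_gradient_le`): with `H = -exp(-s F)` it is a differential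
  inequality for the moment generating function (`measureReal_le_le_exp`).

A net argument passes from finite sets to `S`. The covariance inequality with `F = H` a smoothed
norm also gives `λₙ² ≥ n - 1` (`sub_one_le_expectedGaussianLength_sq`).

*Width of the tangent cone.* A tangent direction has nonpositive inner product with every point of
`t ∂‖x‖₁`, so `sup_{z ∈ Ω} ⟪g, z⟫` is at most the distance of `g` to that set. The mean squared
distance is at most `s (1 + t²) + (p - s) 𝔼(|g| - t)₊²` (`gaussianWidth_sq_le_of_threshold`); the
right side is monotone in the size of the support, which is why a support smaller than `s` is
harmless. With `t² = 2 log(p / s)` and the tail bound `thresholdMoment_le` this is strictly below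
`2 s log(p / s) + 5 s / 4 ≤ n - 1 ≤ λₙ²`, whence `w(Ω) < λₙ`.
-/

/-! ### Gaussian integration by parts -/

lemma hasDerivAt_gaussianPDFReal_zero_one (x : ℝ) :
    HasDerivAt (gaussianPDFReal 0 1) (-x * gaussianPDFReal 0 1 x) x := by
  have h : HasDerivAt (fun y : ℝ => (√(2 * Real.pi * 1))⁻¹ * Real.exp (-(y - 0) ^ 2 / (2 * 1)))
      ((√(2 * Real.pi * 1))⁻¹ * (Real.exp (-(x - 0) ^ 2 / (2 * 1)) *
        (-(2 * (x - 0) ^ (2 - 1) * 1) / (2 * 1)))) x := by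
    have := ((((hasDerivAt_id x).sub_const 0).pow 2).neg.div_const (2 * 1)).exp.const_mul
      ((√(2 * Real.pi * 1))⁻¹)
    simpa using this
  have h2 : gaussianPDFReal 0 1 =
      fun y : ℝ => (√(2 * Real.pi * 1))⁻¹ * Real.exp (-(y - 0) ^ 2 / (2 * 1)) := by
    ext y; simp [gaussianPDFReal]
  rw [h2]
  convert h using 1
  simp
  ring

lemma integrable_gaussianReal_iff {f : ℝ → ℝ} :
    Integrable f (gaussianReal 0 1) ↔ Integrable (fun x => f x * gaussianPDFReal 0 1 x) := by
  rw [gaussianReal_of_var_ne_zero _ one_ne_zero,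
    integrable_withDensity_iff (measurable_gaussianPDF 0 1) (by simp [gaussianPDF])]
  simp [toReal_gaussianPDF]

/-- Gaussian integration by parts on the real line. -/
lemma integral_mul_gaussianReal_eq_integral_deriv {u u' : ℝ → ℝ}
    (hu : ∀ x, HasDerivAt u (u' x) x) (hi : Integrable u (gaussianReal 0 1))
    (hi' : Integrable u' (gaussianReal 0 1))
    (hxi : Integrable (fun x => x * u x) (gaussianReal 0 1)) :
    ∫ x, x * u x ∂(gaussianReal 0 1) = ∫ x, u' x ∂(gaussianReal 0 1) := by
  rw [integrable_gaussianReal_iff] at hi hi' hxi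
  have h := integral_mul_deriv_eq_deriv_mul_of_integrable (u := u) (u' := u')
    (v := gaussianPDFReal 0 1) (v' := fun x => -x * gaussianPDFReal 0 1 x)
    (fun x _ => hu x) (fun x _ => hasDerivAt_gaussianPDFReal_zero_one x)
    (by
      refine hxi.neg.congr (Filter.Eventually.of_forall fun x => ?_)
      simp; ring) hi' hi
  rw [integral_gaussianReal_eq_integral_smul one_ne_zero,
    integral_gaussianReal_eq_integral_smul one_ne_zero]
  simp only [smul_eq_mul]
  have e1 : ∫ x, gaussianPDFReal 0 1 x * (x * u x)
      = - ∫ x, u x * (-x * gaussianPDFReal 0 1 x) := by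
    rw [← integral_neg]; congr 1; ext x; ring
  rw [e1, h, neg_neg]
  congr 1; ext x; ring

section StdGaussian

variable {E : Type*} [NormedAddCommGroup E] [InnerProductSpace ℝ E] [FiniteDimensional ℝ E]
  [MeasurableSpace E] [BorelSpace E]

/-- Resampling the component of a standard Gaussian vector along a unit vector `v` does not change
its law. -/
lemma stdGaussian_map_resample {v : E} (hv : ‖v‖ = 1) :
    ((stdGaussian E).prod (gaussianReal 0 1)).map
      (fun q : E × ℝ => q.1 - inner ℝ q.1 v • v + q.2 • v) = stdGaussian E := by
  have : IsProbabilityMeasure (((stdGaussian E).prod (gaussianReal 0 1)).map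
      (fun q : E × ℝ => q.1 - inner ℝ q.1 v • v + q.2 • v)) :=
    Measure.isProbabilityMeasure_map (Measurable.aemeasurable (by fun_prop))
  apply Measure.ext_of_charFun
  ext t
  have key : ∀ q : E × ℝ, Complex.exp (inner ℝ (q.1 - inner ℝ q.1 v • v + q.2 • v) t * Complex.I)
      = Complex.exp (inner ℝ q.1 (t - inner ℝ v t • v) * Complex.I) *
        Complex.exp (inner ℝ q.2 (inner ℝ v t) * Complex.I) := by
    intro q
    rw [← Complex.exp_add, ← add_mul, ← Complex.ofReal_add]
    congr 3
    simp only [inner_add_left, inner_sub_left, inner_sub_right, inner_smul_left, inner_smul_right]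
    simp
    ring
  rw [charFun_apply, integral_map (Measurable.aemeasurable (by fun_prop))
    (Measurable.aestronglyMeasurable (by fun_prop))]
  simp_rw [key]
  rw [integral_prod_mul (fun x : E => Complex.exp (inner ℝ x (t - inner ℝ v t • v) * Complex.I))
    (fun x : ℝ => Complex.exp (inner ℝ x (inner ℝ v t) * Complex.I)), ← charFun_apply,
    ← charFun_apply, charFun_stdGaussian, charFun_stdGaussian, charFun_gaussianReal,
    ← Complex.exp_add]
  congr 1
  have h : ‖t - inner ℝ v t • v‖ ^ 2 = ‖t‖ ^ 2 - (inner ℝ v t) ^ 2 := by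
    rw [norm_sub_sq_real, norm_smul, hv, inner_smul_right, real_inner_comm]
    simp; ring
  have h' : ((‖t - inner ℝ v t • v‖ : ℂ)) ^ 2 = (‖t‖ : ℂ) ^ 2 - ((inner ℝ v t : ℝ) : ℂ) ^ 2 := by
    exact_mod_cast congrArg (fun r : ℝ => (r : ℂ)) h
  rw [h']
  simp
  ring

/-- **Gaussian integration by parts** (Stein's identity): for a standard Gaussian vector `ξ`,
`𝔼[⟪ξ, v⟫ U(ξ)] = 𝔼[∂ᵥU(ξ)]`. -/
lemma integral_inner_mul_stdGaussian {U U' : E → ℝ} {v : E}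
    (hU : ∀ x, HasDerivAt (fun r : ℝ => U (x + r • v)) (U' x) 0)
    (hi : Integrable U (stdGaussian E)) (hi' : Integrable U' (stdGaussian E))
    (hxi : Integrable (fun x => inner ℝ x v * U x) (stdGaussian E)) :
    ∫ x, inner ℝ x v * U x ∂(stdGaussian E) = ∫ x, U' x ∂(stdGaussian E) := by
  rcases eq_or_ne v 0 with rfl | hv0
  · have : U' = 0 := by
      ext x
      have h1 := hU x
      simp only [smul_zero, add_zero] at h1
      exact h1.unique (hasDerivAt_const 0 (U x))
    simp [this]
  have hn : ‖v‖ ≠ 0 := norm_ne_zero_iff.2 hv0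
  set w : E := ‖v‖⁻¹ • v with hw
  have hw1 : ‖w‖ = 1 := by rw [hw, norm_smul, norm_inv, norm_norm, inv_mul_cancel₀ hn]
  have hvw : v = ‖v‖ • w := by rw [hw, smul_smul, mul_inv_cancel₀ hn, one_smul]
  set φ : E × ℝ → E := fun q => q.1 - inner ℝ q.1 w • w + q.2 • w with hφ
  have hφm : Measurable φ := by fun_prop
  have hmap := stdGaussian_map_resample hw1
  have pull : ∀ {f : E → ℝ}, Integrable f (stdGaussian E) →
      Integrable (fun q => f (φ q)) ((stdGaussian E).prod (gaussianReal 0 1)) := by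
    intro f hf
    rw [← hmap] at hf
    exact hf.comp_measurable hφm
  have eqi : ∀ {f : E → ℝ}, Integrable f (stdGaussian E) →
      ∫ x, f x ∂(stdGaussian E)
        = ∫ x, ∫ r, f (φ (x, r)) ∂(gaussianReal 0 1) ∂(stdGaussian E) := by
    intro f hf
    rw [← integral_prod _ (pull hf)]
    conv_lhs => rw [← hmap]
    rw [integral_map hφm.aemeasurable]
    rw [hmap]; exact hf.aestronglyMeasurable
  have hin : ∀ x r, inner ℝ (φ (x, r)) v = ‖v‖ * r := by
    intro x r
    have hww : inner ℝ w w = (1 : ℝ) := by rw [real_inner_self_eq_norm_sq, hw1]; norm_num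
    rw [hvw, inner_smul_right]
    simp only [hφ, inner_add_left, inner_sub_left, inner_smul_left, hww, norm_smul, hw1]
    simp
  rw [eqi hxi, eqi hi']
  refine integral_congr_ae ?_
  filter_upwards [(pull hi).prod_right_ae, (pull hi').prod_right_ae, (pull hxi).prod_right_ae]
    with x h1 h2 h3
  have hd : ∀ r, HasDerivAt (fun r => U (φ (x, r))) (‖v‖⁻¹ * U' (φ (x, r))) r := by
    intro r
    have h := hU (φ (x, r))
    have h0 : HasDerivAt (fun r' : ℝ => ‖v‖⁻¹ * (r' - r)) ‖v‖⁻¹ r := by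
      simpa using ((hasDerivAt_id r).sub_const r).const_mul (‖v‖⁻¹)
    have hc : HasDerivAt (fun r' => U (φ (x, r) + r' • v)) (U' (φ (x, r))) (‖v‖⁻¹ * (r - r)) := by
      simpa using h
    have hfun : (fun r => U (φ (x, r))) =
        (fun r' => U (φ (x, r) + r' • v)) ∘ fun r' => ‖v‖⁻¹ * (r' - r) := by
      ext r'
      simp only [hφ, hw, smul_smul, Function.comp_apply]
      congr 1
      module
    rw [hfun, mul_comm]
    exact hc.comp r h0
  have hxi' : Integrable (fun r => r * U (φ (x, r))) (gaussianReal 0 1) := by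
    have := h3.const_mul ‖v‖⁻¹
    refine this.congr (Filter.Eventually.of_forall fun r => ?_)
    simp only [hin]
    field_simp
  have := integral_mul_gaussianReal_eq_integral_deriv hd h1 (h2.const_mul _) hxi'
  simp only [hin, mul_assoc]
  rw [integral_const_mul, this, integral_const_mul, ← mul_assoc, mul_inv_cancel₀ hn, one_mul]

end StdGaussian

/-! ### The Gaussian covariance inequality -/

/-- A continuous function of quadratic growth is integrable with respect to a Gaussian measure. -/
lemma integrable_of_quadratic_growth {V : Type*} [NormedAddCommGroup V] [NormedSpace ℝ V]
    [FiniteDimensional ℝ V] [MeasurableSpace V] [BorelSpace V] {μ : Measure V} [IsGaussian μ]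
    {f : V → ℝ} (hf : Continuous f) {C : ℝ} (hC : ∀ x, |f x| ≤ C * (1 + ‖x‖) ^ 2) :
    Integrable f μ := by
  have : ProperSpace V := FiniteDimensional.proper_real V
  have : CompleteSpace V := FiniteDimensional.complete ℝ V
  have : SecondCountableTopology V := secondCountable_of_proper
  have h1 : MemLp (fun x : V => 1 + ‖x‖) 2 μ :=
    (memLp_const (1 : ℝ)).add (IsGaussian.memLp_two_id (μ := μ)).norm
  refine (h1.integrable_sq.const_mul C).mono' hf.aestronglyMeasurable ?_
  exact Filter.Eventually.of_forall fun x => hC x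

lemma norm_sin_smul_add_cos_smul_le {V : Type*} [NormedAddCommGroup V]
    [NormedSpace ℝ V] (θ : ℝ) (x y : V) :
    ‖Real.sin θ • x + Real.cos θ • y‖ ≤ ‖x‖ + ‖y‖ := by
  refine (norm_add_le _ _).trans (add_le_add ?_ ?_) <;> rw [norm_smul, Real.norm_eq_abs]
  · exact mul_le_of_le_one_left (norm_nonneg _) (Real.abs_sin_le_one θ)
  · exact mul_le_of_le_one_left (norm_nonneg _) (Real.abs_cos_le_one θ)

lemma norm_cos_smul_sub_sin_smul_le {V : Type*} [NormedAddCommGroup V]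
    [NormedSpace ℝ V] (θ : ℝ) (x y : V) :
    ‖Real.cos θ • x - Real.sin θ • y‖ ≤ ‖x‖ + ‖y‖ := by
  refine (norm_sub_le _ _).trans (add_le_add ?_ ?_) <;> rw [norm_smul, Real.norm_eq_abs]
  · exact mul_le_of_le_one_left (norm_nonneg _) (Real.abs_cos_le_one θ)
  · exact mul_le_of_le_one_left (norm_nonneg _) (Real.abs_sin_le_one θ)

lemma hasDerivAt_sin_smul_add_cos_smul {V : Type*} [NormedAddCommGroup V]
    [NormedSpace ℝ V] (θ : ℝ) (x y : V) :
    HasDerivAt (fun t => Real.sin t • x + Real.cos t • y)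
      (Real.cos θ • x - Real.sin θ • y) θ := by
  have := ((Real.hasDerivAt_sin θ).smul_const x).add ((Real.hasDerivAt_cos θ).smul_const y)
  simpa [sub_eq_add_neg, Pi.add_def] using this

section Covariance

variable {E : Type*} [NormedAddCommGroup E] [InnerProductSpace ℝ E] [FiniteDimensional ℝ E]
  [MeasurableSpace E] [BorelSpace E]

omit [MeasurableSpace E] [BorelSpace E] in
lemma HasGradientAt.hasDerivAt_comp {F : E → ℝ} {g : E} {c : ℝ → E} {c' : E} {t : ℝ}
    (hF : HasGradientAt F g (c t)) (hc : HasDerivAt c c' t) :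
    HasDerivAt (fun s => F (c s)) (inner ℝ g c') t := by
  simpa [Function.comp_def] using hF.hasFDerivAt.comp_hasDerivAt t hc

omit [MeasurableSpace E] [BorelSpace E] in
lemma abs_sub_le_of_hasGradientAt {F : E → ℝ} {gF : E → E}
    (hF : ∀ x, HasGradientAt F (gF x) x) {C : ℝ} (hC : ∀ x, ‖gF x‖ ≤ C) (x y : E) :
    |F x - F y| ≤ C * ‖x - y‖ := by
  have := Convex.norm_image_sub_le_of_norm_hasFDerivWithin_le (s := Set.univ) (C := C) (𝕜 := ℝ)
    (f := F) (fun z _ => (hF z).hasFDerivAt.hasFDerivWithinAt)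
    (fun z _ => by simpa using hC z) convex_univ (Set.mem_univ y) (Set.mem_univ x)
  simpa using this

omit [MeasurableSpace E] [BorelSpace E] in
lemma abs_le_of_hasGradientAt {F : E → ℝ} {gF : E → E}
    (hF : ∀ x, HasGradientAt F (gF x) x) {C : ℝ} (hC : ∀ x, ‖gF x‖ ≤ C) (x : E) :
    |F x| ≤ (|F 0| + C) * (1 + ‖x‖) := by
  have h1 := abs_sub_le_of_hasGradientAt hF hC x 0
  have hC0 : 0 ≤ C := (norm_nonneg _).trans (hC 0)
  rw [sub_zero] at h1
  have h2 : |F x| ≤ |F 0| + |F x - F 0| := by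
    have := abs_add_le (F 0) (F x - F 0)
    simpa using this
  nlinarith [norm_nonneg x, abs_nonneg (F 0), mul_nonneg (abs_nonneg (F 0)) (norm_nonneg x)]

/-- The product of two copies of the standard Gaussian measure is invariant under the reflections
of the plane of the two copies. -/
lemma stdGaussian_prod_map_reflection (θ : ℝ) :
    ((stdGaussian E).prod (stdGaussian E)).map
      (fun q : E × E => (Real.sin θ • q.1 + Real.cos θ • q.2,
        Real.cos θ • q.1 - Real.sin θ • q.2)) = (stdGaussian E).prod (stdGaussian E) := by
  have hrot := IsGaussian.map_rotation_eq_self (μ := stdGaussian E) (by simp) θ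
  have hswap : ((stdGaussian E).prod (stdGaussian E)).map Prod.swap
      = (stdGaussian E).prod (stdGaussian E) := Measure.prod_swap
  have hcomp : (fun q : E × E => (Real.sin θ • q.1 + Real.cos θ • q.2,
      Real.cos θ • q.1 - Real.sin θ • q.2)) = ContinuousLinearMap.rotation θ ∘ Prod.swap := by
    ext q
    · simp [ContinuousLinearMap.rotation_apply, add_comm]
    · simp [ContinuousLinearMap.rotation_apply, sub_eq_add_neg, add_comm]
  rw [hcomp, ← Measure.map_map (by fun_prop) measurable_swap, hswap, hrot]

/-- A one-sided form of the Gaussian covariance identity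
`Cov(F, H) = ∫₀^{π/2} cos θ 𝔼⟪∇F(sin θ x + cos θ y), ∇H(x)⟫ dθ`. -/
theorem integral_mul_sub_le_of_inner_gradient_le {F H K : E → ℝ} {gF gH : E → E}
    (hF : ∀ x, HasGradientAt F (gF x) x) (hH : ∀ x, HasGradientAt H (gH x) x)
    (hgF : Continuous gF) (hgH : Continuous gH) {C : ℝ} (hFC : ∀ x, ‖gF x‖ ≤ C)
    (hHC : ∀ x, ‖gH x‖ ≤ C) (hK : Integrable K (stdGaussian E))
    (hle : ∀ x y, inner ℝ (gH x) (gF y) ≤ K x) :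
    ∫ x, F x * H x ∂(stdGaussian E)
        - (∫ x, F x ∂(stdGaussian E)) * ∫ x, H x ∂(stdGaussian E)
      ≤ ∫ x, K x ∂(stdGaussian E) := by
  set γ := stdGaussian E with hγ
  have hC0 : 0 ≤ C := (norm_nonneg _).trans (hFC 0)
  have hFcont : Continuous F := continuous_iff_continuousAt.2 fun x => (hF x).continuousAt
  have hHcont : Continuous H := continuous_iff_continuousAt.2 fun x => (hH x).continuousAt
  set A := |F 0| + |H 0| + C with hA
  have hA0 : 0 ≤ A := by positivity
  have hFb : ∀ x, |F x| ≤ A * (1 + ‖x‖) := fun x =>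
    (abs_le_of_hasGradientAt hF hFC x).trans (by gcongr; simp [hA])
  have hHb : ∀ x, |H x| ≤ A * (1 + ‖x‖) := fun x =>
    (abs_le_of_hasGradientAt hH hHC x).trans (by gcongr; simp [hA])
  have hn1 : ∀ q : E × E, ‖q.1‖ ≤ ‖q‖ := norm_fst_le
  have hn2 : ∀ q : E × E, ‖q.2‖ ≤ ‖q‖ := norm_snd_le
  set ρ : ℝ → ℝ := fun θ =>
    ∫ q, F (Real.sin θ • q.1 + Real.cos θ • q.2) * H q.1 ∂(γ.prod γ) with hρ
  set G : ℝ → E × E → ℝ := fun θ q =>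
    inner ℝ (gF (Real.sin θ • q.1 + Real.cos θ • q.2)) (Real.cos θ • q.1 - Real.sin θ • q.2)
      * H q.1 with hG
  have hGb : ∀ θ q, |G θ q| ≤ (2 * C * A) * (1 + ‖q‖) ^ 2 := by
    intro θ q
    rw [hG, abs_mul]
    have h1 : |inner ℝ (gF (Real.sin θ • q.1 + Real.cos θ • q.2))
        (Real.cos θ • q.1 - Real.sin θ • q.2)| ≤ C * (2 * (1 + ‖q‖)) := by
      refine (abs_real_inner_le_norm _ _).trans ?_
      gcongr
      · exact hFC _
      · refine (norm_cos_smul_sub_sin_smul_le θ q.1 q.2).trans ?_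
        linarith [hn1 q, hn2 q]
    have h2 : |H q.1| ≤ A * (1 + ‖q‖) := (hHb _).trans (by gcongr; exact hn1 q)
    calc _ ≤ (C * (2 * (1 + ‖q‖))) * (A * (1 + ‖q‖)) := by gcongr
      _ = _ := by ring
  have hρ' : ∀ θ, HasDerivAt ρ (∫ q, G θ q ∂(γ.prod γ)) θ := by
    intro θ
    refine (hasDerivAt_integral_of_dominated_loc_of_deriv_le (s := Set.univ) Filter.univ_mem
      (bound := fun q => (2 * C * A) * (1 + ‖q‖) ^ 2) (F' := G) ?_ ?_ ?_ ?_ ?_ ?_).2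
    · exact Filter.Eventually.of_forall fun t =>
        (by fun_prop : Continuous fun q : E × E =>
          F (Real.sin t • q.1 + Real.cos t • q.2) * H q.1).aestronglyMeasurable
    · refine integrable_of_quadratic_growth (C := 2 * A * A) (by fun_prop) fun q => ?_
      rw [abs_mul]
      calc _ ≤ (A * (2 * (1 + ‖q‖))) * (A * (1 + ‖q‖)) := by
            gcongr
            · refine (hFb _).trans ?_
              gcongr
              linarith [norm_sin_smul_add_cos_smul_le θ q.1 q.2, hn1 q, hn2 q]
            · exact (hHb _).trans (by gcongr; exact hn1 q)
        _ = _ := by ring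
    · exact (by fun_prop : Continuous (G θ)).aestronglyMeasurable
    · exact Filter.Eventually.of_forall fun q t _ => hGb t q
    · refine integrable_of_quadratic_growth (C := |2 * C * A|) (by fun_prop) fun q => ?_
      rw [abs_mul, abs_of_nonneg (sq_nonneg (1 + ‖q‖))]
    · exact Filter.Eventually.of_forall fun q t _ =>
        ((hF _).hasDerivAt_comp (hasDerivAt_sin_smul_add_cos_smul t q.1 q.2)).mul_const _
  -- After the reflection `(u, w) ↦ (sin θ u + cos θ w, cos θ u - sin θ w)` the derivative is an
  -- integral over `w` to which integration by parts applies.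
  have hGle : ∀ θ, 0 ≤ Real.cos θ →
      ∫ q, G θ q ∂(γ.prod γ) ≤ Real.cos θ * ∫ x, K x ∂γ := by
    intro θ hθ
    set s := Real.sin θ with hs
    set c := Real.cos θ with hc
    have hsc : s * s + c * c = 1 := by
      have := Real.sin_sq_add_cos_sq θ
      rw [hs, hc]; linarith
    have hs1 : |s| ≤ 1 := Real.abs_sin_le_one θ
    have hc1 : |c| ≤ 1 := Real.abs_cos_le_one θ
    have hmap := stdGaussian_prod_map_reflection (E := E) θ
    have e1 : ∫ q, G θ q ∂(γ.prod γ)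
        = ∫ q : E × E, inner ℝ q.2 (gF q.1) * H (s • q.1 + c • q.2) ∂(γ.prod γ) := by
      conv_lhs => rw [hγ, ← hmap]
      rw [integral_map (by fun_prop)
        (by fun_prop : Continuous (G θ)).aestronglyMeasurable]
      congr 1
      ext q
      have a1 : s • (s • q.1 + c • q.2) + c • (c • q.1 - s • q.2) = q.1 := by
        have : s • (s • q.1 + c • q.2) + c • (c • q.1 - s • q.2) = (s * s + c * c) • q.1 := by
          module
        rw [this, hsc, one_smul]
      have a2 : c • (s • q.1 + c • q.2) - s • (c • q.1 - s • q.2) = q.2 := by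
        have : c • (s • q.1 + c • q.2) - s • (c • q.1 - s • q.2) = (s * s + c * c) • q.2 := by
          module
        rw [this, hsc, one_smul]
      simp only [hG, ← hs, ← hc, a1, a2]
      rw [real_inner_comm]
    have i1 : Integrable (fun q : E × E => inner ℝ q.2 (gF q.1) * H (s • q.1 + c • q.2))
        (γ.prod γ) := by
      refine integrable_of_quadratic_growth (C := 2 * C * A) (by fun_prop) fun q => ?_
      rw [abs_mul]
      calc _ ≤ ((1 + ‖q‖) * C) * (A * (2 * (1 + ‖q‖))) := by
            gcongr
            · refine (abs_real_inner_le_norm _ _).trans ?_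
              gcongr
              · linarith [hn2 q]
              · exact hFC _
            · refine (hHb _).trans ?_
              gcongr
              linarith [norm_sin_smul_add_cos_smul_le θ q.1 q.2, hn1 q, hn2 q]
        _ = _ := by ring
    have hinb : ∀ x y, |inner ℝ (gH x) (gF y)| ≤ C * C := fun x y =>
      (abs_real_inner_le_norm _ _).trans (by gcongr; exacts [hHC x, hFC y])
    have i2 : Integrable (fun q : E × E => c * inner ℝ (gH (s • q.1 + c • q.2)) (gF q.1))
        (γ.prod γ) := by
      refine integrable_of_quadratic_growth (C := C * C) (by fun_prop) fun q => ?_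
      rw [abs_mul]
      have : 1 ≤ (1 + ‖q‖) ^ 2 := by nlinarith [norm_nonneg q]
      calc _ ≤ 1 * (C * C) := by gcongr; exact hinb _ _
        _ ≤ C * C * (1 + ‖q‖) ^ 2 := by nlinarith [mul_nonneg hC0 hC0]
    have e2 : ∫ q : E × E, inner ℝ q.2 (gF q.1) * H (s • q.1 + c • q.2) ∂(γ.prod γ)
        = ∫ q : E × E, c * inner ℝ (gH (s • q.1 + c • q.2)) (gF q.1) ∂(γ.prod γ) := by
      rw [integral_prod _ i1, integral_prod _ i2]
      congr 1
      ext u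
      have hub : ∀ w, |H (s • u + c • w)| ≤ (A * (1 + ‖u‖)) * (1 + ‖w‖) := by
        intro w
        refine (hHb _).trans ?_
        rw [mul_assoc]
        gcongr
        nlinarith [norm_sin_smul_add_cos_smul_le θ u w, norm_nonneg u, norm_nonneg w,
          mul_nonneg (norm_nonneg u) (norm_nonneg w)]
      refine integral_inner_mul_stdGaussian (v := gF u)
        (U := fun w => H (s • u + c • w))
        (U' := fun w => c * inner ℝ (gH (s • u + c • w)) (gF u)) ?_ ?_ ?_ ?_
      · intro w
        have hcurve : HasDerivAt (fun r : ℝ => s • u + c • (w + r • gF u)) (c • gF u) 0 := by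
          have := (((hasDerivAt_id (0 : ℝ)).smul_const (gF u)).const_add w).const_smul c
          simpa using this.const_add (s • u)
        have h0 : HasGradientAt H (gH (s • u + c • w)) (s • u + c • (w + (0 : ℝ) • gF u)) := by
          simpa using hH (s • u + c • w)
        have := h0.hasDerivAt_comp hcurve
        rwa [inner_smul_right] at this
      · refine integrable_of_quadratic_growth (C := A * (1 + ‖u‖)) (by fun_prop) fun w => ?_
        refine (hub w).trans ?_
        gcongr
        nlinarith [norm_nonneg w]
      · refine integrable_of_quadratic_growth (C := C * C) (by fun_prop) fun w => ?_
        rw [abs_mul]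
        have : 1 ≤ (1 + ‖w‖) ^ 2 := by nlinarith [norm_nonneg w]
        calc _ ≤ 1 * (C * C) := by gcongr; exact hinb _ _
          _ ≤ C * C * (1 + ‖w‖) ^ 2 := by nlinarith [mul_nonneg hC0 hC0]
      · refine integrable_of_quadratic_growth (C := C * (A * (1 + ‖u‖))) (by fun_prop) fun w => ?_
        rw [abs_mul]
        calc _ ≤ ((1 + ‖w‖) * C) * ((A * (1 + ‖u‖)) * (1 + ‖w‖)) := by
              gcongr
              · refine (abs_real_inner_le_norm _ _).trans ?_
                gcongr
                · linarith
                · exact hFC _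
              · exact hub w
          _ = _ := by ring
    have hmapK : ∫ q : E × E, c * K (s • q.1 + c • q.2) ∂(γ.prod γ) = c * ∫ x, K x ∂γ := by
      rw [integral_const_mul]
      congr 1
      have hK1 : Integrable (fun q : E × E => K q.1) (γ.prod γ) := hK.comp_fst γ
      have h1 : ∫ q : E × E, K q.1 ∂(γ.prod γ) = ∫ x, K x ∂γ := by
        rw [integral_prod _ hK1]; simp
      rw [← h1]
      conv_rhs => rw [hγ, ← hmap]
      rw [integral_map (by fun_prop)]
      rw [hmap]; exact hK1.aestronglyMeasurable
    have iK : Integrable (fun q : E × E => c * K (s • q.1 + c • q.2)) (γ.prod γ) := by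
      have hK1 : Integrable (fun q : E × E => K q.1) (γ.prod γ) := hK.comp_fst γ
      rw [hγ, ← hmap] at hK1
      exact (hK1.comp_measurable (by fun_prop)).const_mul c
    rw [e1, e2, ← hmapK]
    exact integral_mono i2 iK fun q => mul_le_mul_of_nonneg_left (hle _ _) hθ
  set κ := ∫ x, K x ∂γ with hκ
  have hanti : AntitoneOn (fun θ => ρ θ - Real.sin θ * κ) (Set.Icc 0 (Real.pi / 2)) := by
    refine antitoneOn_of_hasDerivWithinAt_nonpos (convex_Icc _ _)
      (f' := fun θ => ∫ q, G θ q ∂(γ.prod γ) - Real.cos θ * κ) ?_ ?_ ?_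
    · exact fun θ _ => ((hρ' θ).sub
        ((Real.hasDerivAt_sin θ).mul_const κ)).continuousAt.continuousWithinAt
    · exact fun θ _ => ((hρ' θ).sub ((Real.hasDerivAt_sin θ).mul_const κ)).hasDerivWithinAt
    · intro θ hθ
      rw [interior_Icc] at hθ
      have := hGle θ (Real.cos_nonneg_of_neg_pi_div_two_le_of_le
        (by linarith [hθ.1, Real.pi_pos]) hθ.2.le)
      linarith
  have hfin := hanti (Set.left_mem_Icc.2 (by positivity)) (Set.right_mem_Icc.2 (by positivity))
    (by positivity)
  have r0 : ρ 0 = (∫ x, F x ∂γ) * ∫ x, H x ∂γ := by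
    simp only [hρ, Real.sin_zero, Real.cos_zero, zero_smul, one_smul, zero_add]
    rw [mul_comm, ← integral_prod_mul (μ := γ) (ν := γ) H F]
    simp_rw [mul_comm]
  have r1 : ρ (Real.pi / 2) = ∫ x, F x * H x ∂γ := by
    simp only [hρ, Real.sin_pi_div_two, Real.cos_pi_div_two, zero_smul, one_smul, add_zero]
    rw [integral_fun_fst (fun x => F x * H x)]
    simp
  simp only [Real.sin_zero, Real.sin_pi_div_two, r0, r1] at hfin
  linarith

end Covariance

/-! ### Gaussian concentration and the mean length of a Gaussian vector -/

section Concentration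

variable {E : Type*} [NormedAddCommGroup E] [InnerProductSpace ℝ E] [FiniteDimensional ℝ E]
  [MeasurableSpace E] [BorelSpace E]

/-- Lower-tail moment generating function of a `1`-Lipschitz function of a Gaussian vector. -/
lemma integral_exp_neg_mul_le {F : E → ℝ} {gF : E → E} (hF : ∀ x, HasGradientAt F (gF x) x)
    (hgF : Continuous gF) (hF1 : ∀ x, ‖gF x‖ ≤ 1) {B : ℝ} (hB : ∀ x, -B ≤ F x) {s : ℝ}
    (hs : 0 ≤ s) :
    ∫ x, Real.exp (-s * F x) ∂(stdGaussian E)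
      ≤ Real.exp (-s * ∫ x, F x ∂(stdGaussian E) + s ^ 2 / 2) := by
  set γ := stdGaussian E with hγ
  set m := ∫ x, F x ∂γ with hm
  have hFcont : Continuous F := continuous_iff_continuousAt.2 fun x => (hF x).continuousAt
  have hFint : Integrable F γ := by
    refine integrable_of_quadratic_growth (C := |F 0| + 1) hFcont fun x =>
      (abs_le_of_hasGradientAt hF hF1 x).trans ?_
    gcongr
    nlinarith [norm_nonneg x]
  have hexp : ∀ {t : ℝ}, 0 ≤ t → ∀ {T : ℝ}, t ≤ T → ∀ x,
      Real.exp (-t * F x) ≤ Real.exp (T * |B|) := by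
    intro t ht T hT x
    refine Real.exp_le_exp.2 ?_
    have h1 : -F x ≤ |B| := (neg_le.1 (hB x)).trans (le_abs_self B)
    nlinarith [abs_nonneg B, mul_le_mul_of_nonneg_left h1 ht,
      mul_le_mul_of_nonneg_right hT (abs_nonneg B)]
  have hint : ∀ {t : ℝ}, 0 ≤ t → Integrable (fun x => Real.exp (-t * F x)) γ := by
    intro t ht
    refine (integrable_const (Real.exp (t * |B|))).mono'
      (by fun_prop : Continuous fun x => Real.exp (-t * F x)).aestronglyMeasurable ?_
    exact Filter.Eventually.of_forall fun x => by
      rw [Real.norm_eq_abs, Real.abs_exp]; exact hexp ht le_rfl x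
  set M : ℝ → ℝ := fun t => ∫ x, Real.exp (-t * F x) ∂γ with hM
  have hMderiv : ∀ t, 0 < t → HasDerivAt M (∫ x, -F x * Real.exp (-t * F x) ∂γ) t := by
    intro t ht
    refine (hasDerivAt_integral_of_dominated_loc_of_deriv_le (s := Set.Ioo 0 (t + 1))
      (Ioo_mem_nhds ht (by linarith)) (bound := fun x => |F x| * Real.exp ((t + 1) * |B|))
      (F' := fun t x => -F x * Real.exp (-t * F x)) ?_ (hint ht.le) ?_ ?_ ?_ ?_).2
    · exact Filter.Eventually.of_forall fun r =>
        (by fun_prop : Continuous fun x => Real.exp (-r * F x)).aestronglyMeasurable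
    · exact (by fun_prop : Continuous fun x => -F x * Real.exp (-t * F x)).aestronglyMeasurable
    · refine Filter.Eventually.of_forall fun x r hr => ?_
      rw [norm_mul, norm_neg, Real.norm_eq_abs, Real.norm_eq_abs, Real.abs_exp]
      exact mul_le_mul_of_nonneg_left (hexp hr.1.le hr.2.le x) (abs_nonneg _)
    · exact hFint.abs.mul_const _
    · refine Filter.Eventually.of_forall fun x r _ => ?_
      exact ((hasDerivAt_id r).fun_neg.mul_const (F x)).exp.congr_deriv (by simp; ring)
  have hMcont : ContinuousOn M (Set.Ici 0) := by
    intro t ht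
    have ht0 : (0 : ℝ) ≤ t := ht
    refine continuousWithinAt_of_dominated (bound := fun _ => Real.exp ((t + 1) * |B|)) ?_ ?_
      (integrable_const _) ?_
    · exact Filter.Eventually.of_forall fun r =>
        (by fun_prop : Continuous fun x => Real.exp (-r * F x)).aestronglyMeasurable
    · have h1 : ∀ᶠ r in nhdsWithin t (Set.Ici 0), r < t + 1 :=
        nhdsWithin_le_nhds (Iio_mem_nhds (by linarith))
      filter_upwards [self_mem_nhdsWithin, h1] with r hr hr1
      refine Filter.Eventually.of_forall fun x => ?_
      rw [Real.norm_eq_abs, Real.abs_exp]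
      exact hexp hr hr1.le x
    · exact Filter.Eventually.of_forall fun x =>
        (by fun_prop : Continuous fun r => Real.exp (-r * F x)).continuousWithinAt
  -- The covariance inequality for `F` and `-exp (-t F)` is a differential inequality for `M`.
  have hdiff : ∀ t, 0 < t → ∫ x, -F x * Real.exp (-t * F x) ∂γ + m * M t ≤ t * M t := by
    intro t ht
    have hH : ∀ x, HasGradientAt (fun x => -Real.exp (-t * F x))
        ((t * Real.exp (-t * F x)) • gF x) x := by
      intro x
      rw [hasGradientAt_iff_hasFDerivAt]
      refine ((hF x).hasFDerivAt.const_mul (-t)).exp.fun_neg.congr_fderiv ?_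
      rw [map_smul]
      ext y
      simp
      ring
    have hle : ∀ x y, inner ℝ ((t * Real.exp (-t * F x)) • gF x) (gF y)
        ≤ t * Real.exp (-t * F x) := by
      intro x y
      rw [real_inner_smul_left]
      have h1 : inner ℝ (gF x) (gF y) ≤ 1 := (real_inner_le_norm _ _).trans
        (mul_le_one₀ (hF1 x) (norm_nonneg _) (hF1 y))
      exact mul_le_of_le_one_right (mul_nonneg ht.le (Real.exp_pos _).le) h1
    have := integral_mul_sub_le_of_inner_gradient_le (C := max 1 (t * Real.exp (t * |B|))) hF hH
      hgF (by fun_prop) (fun x => (hF1 x).trans (le_max_left _ _)) (fun x => by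
        have h0 : 0 ≤ t * Real.exp (-t * F x) := mul_nonneg ht.le (Real.exp_pos _).le
        rw [norm_smul, Real.norm_of_nonneg h0]
        exact le_max_of_le_right ((mul_le_of_le_one_right h0 (hF1 x)).trans
          (mul_le_mul_of_nonneg_left (hexp ht.le le_rfl x) ht.le))) ((hint ht.le).const_mul t) hle
    rw [integral_const_mul, integral_neg] at this
    have e : ∫ x, F x * -Real.exp (-t * F x) ∂γ = ∫ x, -F x * Real.exp (-t * F x) ∂γ := by
      congr 1; ext x; ring
    rw [← hγ, e] at this
    simp only [hM]
    linarith
  have hanti : AntitoneOn (fun t => M t * Real.exp (m * t - t ^ 2 / 2)) (Set.Ici 0) := by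
    have hE : ∀ t, HasDerivAt (fun t => Real.exp (m * t - t ^ 2 / 2))
        (Real.exp (m * t - t ^ 2 / 2) * (m - t)) t := by
      intro t
      exact (((hasDerivAt_id t).const_mul m).fun_sub
        (((hasDerivAt_id t).fun_pow 2).div_const 2)).exp.congr_deriv (by simp)
    refine antitoneOn_of_hasDerivWithinAt_nonpos (convex_Ici _)
      (f' := fun t => (∫ x, -F x * Real.exp (-t * F x) ∂γ) * Real.exp (m * t - t ^ 2 / 2)
        + M t * (Real.exp (m * t - t ^ 2 / 2) * (m - t))) ?_ ?_ ?_
    · exact hMcont.mul (by fun_prop)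
    · intro t ht
      rw [interior_Ici] at ht
      exact ((hMderiv t ht).mul (hE t)).hasDerivWithinAt
    · intro t ht
      rw [interior_Ici] at ht
      have h1 := hdiff t ht
      have h2 := Real.exp_pos (m * t - t ^ 2 / 2)
      nlinarith
  have h0 := hanti (Set.self_mem_Ici) (Set.mem_Ici.2 hs) hs
  have hM0 : M 0 = 1 := by simp [hM]
  simp only [hM0, mul_zero, ne_eq, OfNat.ofNat_ne_zero, not_false_eq_true, zero_pow, zero_div,
    sub_zero, Real.exp_zero, mul_one] at h0
  have : M s ≤ 1 / Real.exp (m * s - s ^ 2 / 2) := by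
    rw [le_div_iff₀ (Real.exp_pos _)]; exact h0
  rw [one_div, ← Real.exp_neg] at this
  refine this.trans_eq ?_
  congr 1
  ring

/-- **Gaussian concentration**, with the sharp constant, for the lower tail of a `1`-Lipschitz
function that is bounded below. -/
theorem measureReal_le_le_exp {F : E → ℝ} {gF : E → E} (hF : ∀ x, HasGradientAt F (gF x) x)
    (hgF : Continuous gF) (hF1 : ∀ x, ‖gF x‖ ≤ 1) {B : ℝ} (hB : ∀ x, -B ≤ F x) {a : ℝ}
    (ha : a ≤ ∫ x, F x ∂(stdGaussian E)) :
    (stdGaussian E).real {x | F x ≤ a}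
      ≤ Real.exp (-((∫ x, F x ∂(stdGaussian E)) - a) ^ 2 / 2) := by
  set m := ∫ x, F x ∂(stdGaussian E) with hm
  have hFcont : Continuous F := continuous_iff_continuousAt.2 fun x => (hF x).continuousAt
  have hs : 0 ≤ m - a := sub_nonneg.2 ha
  have hint : Integrable (fun x => Real.exp (-(m - a) * F x)) (stdGaussian E) := by
    refine (integrable_const (Real.exp ((m - a) * B))).mono'
      (by fun_prop : Continuous fun x => Real.exp (-(m - a) * F x)).aestronglyMeasurable ?_
    refine Filter.Eventually.of_forall fun x => ?_
    rw [Real.norm_eq_abs, Real.abs_exp, Real.exp_le_exp]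
    nlinarith [mul_le_mul_of_nonneg_left (hB x) hs]
  have h1 := measure_le_le_exp_mul_mgf (μ := stdGaussian E) (X := F) a (neg_nonpos.2 hs) hint
  refine h1.trans ?_
  have h2 : mgf F (stdGaussian E) (-(m - a)) ≤ Real.exp (-(m - a) * m + (m - a) ^ 2 / 2) :=
    integral_exp_neg_mul_le hF hgF hF1 hB hs
  refine (mul_le_mul_of_nonneg_left h2 (Real.exp_pos _).le).trans_eq ?_
  rw [← Real.exp_add]
  congr 1
  ring

end Concentration

section SmoothNorm

variable {E : Type*} [NormedAddCommGroup E] [InnerProductSpace ℝ E]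

/-- The smooth convex approximation `√(ε² + ‖x‖²)` of the norm. -/
noncomputable def smoothNorm (ε : ℝ) (x : E) : ℝ := √(ε ^ 2 + ‖x‖ ^ 2)

/-- The gradient `x / √(ε² + ‖x‖²)` of `smoothNorm ε`. -/
noncomputable def smoothNormGrad (ε : ℝ) (x : E) : E := (smoothNorm ε x)⁻¹ • x

omit [InnerProductSpace ℝ E] in
lemma norm_le_smoothNorm (ε : ℝ) (x : E) : ‖x‖ ≤ smoothNorm ε x :=
  Real.le_sqrt_of_sq_le (by nlinarith [sq_nonneg ε])

omit [InnerProductSpace ℝ E] in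
lemma smoothNorm_le {ε : ℝ} (hε : 0 ≤ ε) (x : E) : smoothNorm ε x ≤ ‖x‖ + ε := by
  refine Real.sqrt_le_iff.2 ⟨by positivity, ?_⟩
  nlinarith [mul_nonneg hε (norm_nonneg x)]

omit [InnerProductSpace ℝ E] in
lemma smoothNorm_pos {ε : ℝ} (hε : 0 < ε) (x : E) : 0 < smoothNorm ε x :=
  Real.sqrt_pos.2 (by positivity)

omit [InnerProductSpace ℝ E] in
lemma smoothNorm_sq (ε : ℝ) (x : E) : smoothNorm ε x ^ 2 = ε ^ 2 + ‖x‖ ^ 2 :=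
  Real.sq_sqrt (by positivity)

omit [InnerProductSpace ℝ E] in
lemma continuous_smoothNorm (ε : ℝ) : Continuous (smoothNorm ε : E → ℝ) := by
  unfold smoothNorm; fun_prop

lemma continuous_smoothNormGrad {ε : ℝ} (hε : 0 < ε) :
    Continuous (smoothNormGrad ε : E → E) := by
  unfold smoothNormGrad
  exact ((continuous_smoothNorm ε).inv₀ fun x => (smoothNorm_pos hε x).ne').smul continuous_id

lemma norm_smoothNormGrad_le {ε : ℝ} (hε : 0 < ε) (x : E) : ‖smoothNormGrad ε x‖ ≤ 1 := by
  rw [smoothNormGrad, norm_smul, norm_inv, Real.norm_of_nonneg (smoothNorm_pos hε x).le,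
    inv_mul_le_iff₀ (smoothNorm_pos hε x), mul_one]
  exact norm_le_smoothNorm ε x

lemma hasDerivAt_smoothNorm {ε : ℝ} (hε : 0 < ε) {c : ℝ → E} {c' : E} {t : ℝ}
    (hc : HasDerivAt c c' t) :
    HasDerivAt (fun s => smoothNorm ε (c s)) (inner ℝ (smoothNormGrad ε (c t)) c') t := by
  have h1 := (hc.norm_sq.const_add (ε ^ 2)).sqrt (by positivity)
  refine h1.congr_deriv ?_
  rw [smoothNormGrad, inner_smul_left]
  simp only [smoothNorm, map_inv₀, conj_trivial]
  rw [mul_div_mul_left _ _ two_ne_zero]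
  ring

lemma hasGradientAt_smoothNorm [CompleteSpace E] {ε : ℝ} (hε : 0 < ε) (x : E) :
    HasGradientAt (smoothNorm ε) (smoothNormGrad ε x) x := by
  rw [hasGradientAt_iff_hasFDerivAt]
  have h1 := ((hasStrictFDerivAt_norm_sq x).hasFDerivAt.const_add (ε ^ 2)).sqrt (by positivity)
  refine HasFDerivAt.congr_fderiv (f := smoothNorm ε) h1 ?_
  ext y
  simp [smoothNormGrad, smoothNorm]
  ring

/-- The derivative of `smoothNormGrad ε` along a line, in the direction `v`. -/
noncomputable def smoothNormHess (ε : ℝ) (x v : E) : E :=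
  (smoothNorm ε x)⁻¹ • v - ((inner ℝ x v) / smoothNorm ε x ^ 3) • x

lemma hasDerivAt_smoothNormGrad {ε : ℝ} (hε : 0 < ε) (x v : E) :
    HasDerivAt (fun r : ℝ => smoothNormGrad ε (x + r • v)) (smoothNormHess ε x v) 0 := by
  have hc : HasDerivAt (fun r : ℝ => x + r • v) v 0 := by
    simpa using ((hasDerivAt_id (0 : ℝ)).smul_const v).const_add x
  have h1 := hasDerivAt_smoothNorm hε hc
  have h2 := (h1.fun_inv (smoothNorm_pos hε _).ne').fun_smul hc
  refine HasDerivAt.congr_deriv (f := fun r : ℝ => smoothNormGrad ε (x + r • v)) h2 ?_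
  have := (smoothNorm_pos hε x).ne'
  simp only [zero_smul, add_zero, smoothNormHess, smoothNormGrad, inner_smul_left]
  rw [sub_eq_add_neg, ← neg_smul]
  congr 2
  simp
  field_simp

end SmoothNorm

section GaussianLength

variable {E : Type*} [NormedAddCommGroup E] [InnerProductSpace ℝ E] [FiniteDimensional ℝ E]
  [MeasurableSpace E] [BorelSpace E]

lemma integral_inner_sq_stdGaussian (v : E) :
    ∫ x, inner ℝ x v ^ 2 ∂(stdGaussian E) = ‖v‖ ^ 2 := by
  have hb : ∀ x : E, |inner ℝ x v| ≤ ‖v‖ * (1 + ‖x‖) := fun x =>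
    (abs_real_inner_le_norm x v).trans (by nlinarith [norm_nonneg v, norm_nonneg x])
  have := integral_inner_mul_stdGaussian (v := v) (U := fun x => inner ℝ x v)
    (U' := fun _ => inner ℝ v v) (fun x => by
      have hc : HasDerivAt (fun r : ℝ => x + r • v) v 0 := by
        simpa using ((hasDerivAt_id (0 : ℝ)).smul_const v).const_add x
      simpa using hc.inner ℝ (hasDerivAt_const 0 v))
    (integrable_of_quadratic_growth (C := ‖v‖) (by fun_prop) fun x => (hb x).trans (by
      gcongr; nlinarith [norm_nonneg x])) (integrable_const _)
    (integrable_of_quadratic_growth (C := ‖v‖ * ‖v‖) (by fun_prop) fun x => by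
      rw [abs_mul]
      calc _ ≤ (‖v‖ * (1 + ‖x‖)) * (‖v‖ * (1 + ‖x‖)) := by gcongr <;> exact hb x
        _ = _ := by ring)
  simp_rw [pow_two]
  rw [this]
  simp [pow_two]

lemma integral_norm_sq_stdGaussian (n : ℕ) :
    ∫ x, ‖x‖ ^ 2 ∂(stdGaussian (EuclideanSpace ℝ (Fin n))) = n := by
  set b := EuclideanSpace.basisFun (Fin n) ℝ
  have h : ∀ x : EuclideanSpace ℝ (Fin n), ‖x‖ ^ 2 = ∑ i, inner ℝ x (b i) ^ 2 := fun x => by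
    rw [← b.sum_sq_inner_left]
  simp_rw [h]
  rw [integral_finsetSum]
  · simp [integral_inner_sq_stdGaussian]
  · intro i _
    refine integrable_of_quadratic_growth (C := 1) (by fun_prop) fun x => ?_
    rw [abs_pow]
    have := abs_real_inner_le_norm x (b i)
    rw [b.norm_eq_one i, mul_one] at this
    rw [one_mul]
    gcongr
    linarith

lemma integrable_norm_stdGaussian : Integrable (fun x : E => ‖x‖) (stdGaussian E) :=
  integrable_of_quadratic_growth (C := 1) continuous_norm fun x => by
    rw [abs_norm]; nlinarith [norm_nonneg x]

lemma expectedGaussianLength_nonneg (n : ℕ) : 0 ≤ expectedGaussianLength n :=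
  integral_nonneg fun _ => norm_nonneg _

/-- The length of a standard Gaussian vector has variance at most one. -/
lemma sub_one_le_expectedGaussianLength_sq (n : ℕ) :
    (n : ℝ) - 1 ≤ expectedGaussianLength n ^ 2 := by
  set γ := stdGaussian (EuclideanSpace ℝ (Fin n)) with hγ
  have key : ∀ ε : ℝ, 0 < ε → (n : ℝ) - 1 ≤ (expectedGaussianLength n + ε) ^ 2 := by
    intro ε hε
    have h := integral_mul_sub_le_of_inner_gradient_le (E := EuclideanSpace ℝ (Fin n)) (C := 1)
      (K := fun _ => 1) (hasGradientAt_smoothNorm hε) (hasGradientAt_smoothNorm hε)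
      (continuous_smoothNormGrad hε) (continuous_smoothNormGrad hε) (norm_smoothNormGrad_le hε)
      (norm_smoothNormGrad_le hε) (integrable_const _)
      (fun x y => (real_inner_le_norm _ _).trans (mul_le_one₀ (norm_smoothNormGrad_le hε x)
        (norm_nonneg _) (norm_smoothNormGrad_le hε y)))
    have hsq : Integrable (fun x : EuclideanSpace ℝ (Fin n) => ‖x‖ ^ 2) γ :=
      integrable_of_quadratic_growth (C := 1) (by fun_prop) fun x => by
        rw [abs_pow, abs_norm, one_mul]; gcongr; linarith
    have h1 : ∫ x, smoothNorm ε x * smoothNorm ε x ∂γ = ε ^ 2 + n := by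
      simp_rw [← pow_two, smoothNorm_sq]
      rw [integral_add (integrable_const _) hsq, hγ, integral_norm_sq_stdGaussian]
      simp
    have h2 : ∫ x, smoothNorm ε x ∂γ ≤ expectedGaussianLength n + ε := by
      calc ∫ x, smoothNorm ε x ∂γ ≤ ∫ x, (‖x‖ + ε) ∂γ := by
            refine integral_mono ?_ (integrable_norm_stdGaussian.add (integrable_const _))
              fun x => smoothNorm_le hε.le x
            refine (integrable_norm_stdGaussian.add (integrable_const ε)).mono'
              (continuous_smoothNorm ε).aestronglyMeasurable ?_
            refine Filter.Eventually.of_forall fun x => ?_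
            rw [Real.norm_of_nonneg (smoothNorm_pos hε x).le]
            exact smoothNorm_le hε.le x
        _ = _ := by
            rw [integral_add integrable_norm_stdGaussian (integrable_const _)]
            simp [expectedGaussianLength]
    have h3 : 0 ≤ ∫ x, smoothNorm ε x ∂γ := integral_nonneg fun x => (smoothNorm_pos hε x).le
    rw [← hγ, h1] at h
    simp only [integral_const, probReal_univ, smul_eq_mul, mul_one] at h
    nlinarith [sq_nonneg ε]
  have ht : Filter.Tendsto (fun ε : ℝ => (expectedGaussianLength n + ε) ^ 2)
      (nhdsWithin 0 (Set.Ioi 0)) (nhds ((expectedGaussianLength n + 0) ^ 2)) :=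
    ((by fun_prop : Continuous fun ε : ℝ => (expectedGaussianLength n + ε) ^ 2).tendsto 0).mono_left
      nhdsWithin_le_nhds
  rw [add_zero] at ht
  exact ge_of_tendsto ht (by filter_upwards [self_mem_nhdsWithin] with ε hε using key ε hε)

end GaussianLength

/-! ### Gaussian interpolation -/

section Interpolation

variable {V : Type*} [NormedAddCommGroup V] [NormedSpace ℝ V]

/-- Gaussian integration by parts for `𝔼[DΨ(z₀ + s A ξ)(A ξ)]`, which turns it into a trace of the
second derivative of `Ψ`. -/
lemma integral_apply_stdGaussian_eq_trace {E ι : Type*} [NormedAddCommGroup E]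
    [InnerProductSpace ℝ E] [FiniteDimensional ℝ E] [MeasurableSpace E] [BorelSpace E] [Fintype ι]
    (b : OrthonormalBasis ι ℝ E) (A : E →L[ℝ] V) {D : V → V →L[ℝ] ℝ} {D2 : V → V → ℝ} {C : ℝ}
    {C2 : V → ℝ} (hD2 : ∀ z v, HasDerivAt (fun r : ℝ => D (z + r • v) v) (D2 z v) 0)
    (hDc : Continuous D) (hDb : ∀ z, ‖D z‖ ≤ C) (hD2c : ∀ v, Continuous fun z => D2 z v)
    (hD2b : ∀ z v, |D2 z v| ≤ C2 v) (z₀ : V) (s : ℝ) :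
    ∫ x, D (z₀ + s • A x) (A x) ∂(stdGaussian E)
      = s * ∫ x, ∑ k, D2 (z₀ + s • A x) (A (b k)) ∂(stdGaussian E) := by
  have hsum : ∀ x, D (z₀ + s • A x) (A x)
      = ∑ k, inner ℝ x (b k) * D (z₀ + s • A x) (A (b k)) := by
    intro x
    generalize D (z₀ + s • A x) = L
    conv_lhs => rw [← b.sum_repr x]
    simp [b.repr_apply_apply, real_inner_comm]
  have hDv : ∀ z v, |D z v| ≤ C * ‖v‖ := fun z v =>
    ((D z).le_opNorm v).trans (by gcongr; exact hDb z)
  have hC0 : 0 ≤ C := (norm_nonneg _).trans (hDb 0)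
  have i1 : ∀ v, Integrable (fun x => D (z₀ + s • A x) v) (stdGaussian E) := fun v =>
    integrable_of_quadratic_growth (C := C * ‖v‖) (by fun_prop) fun x =>
      (hDv _ _).trans (le_mul_of_one_le_right (by positivity) (by nlinarith [norm_nonneg x]))
  have i2 : ∀ v, Integrable (fun x => s * D2 (z₀ + s • A x) v) (stdGaussian E) := fun v =>
    Integrable.const_mul (integrable_of_quadratic_growth (C := C2 v)
      ((hD2c v).comp (by fun_prop)) fun x => (hD2b _ _).trans
        (le_mul_of_one_le_right ((abs_nonneg _).trans (hD2b 0 v))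
          (by nlinarith [norm_nonneg x]))) s
  have i3 : ∀ k, Integrable (fun x => inner ℝ x (b k) * D (z₀ + s • A x) (A (b k)))
      (stdGaussian E) := fun k =>
    integrable_of_quadratic_growth (C := C * ‖A (b k)‖) (by fun_prop) fun x => by
      rw [abs_mul]
      have h1 : |inner ℝ x (b k)| ≤ (1 + ‖x‖) ^ 2 := by
        have := abs_real_inner_le_norm x (b k)
        rw [b.norm_eq_one, mul_one] at this
        nlinarith [norm_nonneg x]
      rw [mul_comm (C * _)]
      gcongr
      exact hDv _ _
  simp_rw [hsum]
  rw [integral_finsetSum _ fun k _ => i3 k, ← integral_const_mul]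
  simp_rw [Finset.mul_sum]
  rw [integral_finsetSum _ fun k _ => i2 _]
  refine Finset.sum_congr rfl fun k _ => ?_
  refine integral_inner_mul_stdGaussian (fun x => ?_) (i1 _) (i2 _) (i3 k)
  have h0 : HasDerivAt (fun r : ℝ => s * r) s 0 := by
    simpa using (hasDerivAt_id (0 : ℝ)).const_mul s
  have h1 : HasDerivAt (fun r : ℝ => D ((z₀ + s • A x) + r • A (b k)) (A (b k)))
      (D2 (z₀ + s • A x) (A (b k))) (s * 0) := by
    rw [mul_zero]; exact hD2 _ _
  have h2 := h1.comp 0 h0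
  refine HasDerivAt.congr_deriv (f := fun r : ℝ => D (z₀ + s • A (x + r • b k)) (A (b k)))
    (h2.congr_of_eventuallyEq (Filter.Eventually.of_forall fun r => ?_)) (mul_comm _ _)
  simp only [Function.comp_apply, map_add, map_smul]
  congr 2
  module

/-- **Gaussian interpolation**: if the second derivative of `Ψ` has a larger trace against the
covariance of `A ξ` than against that of `B η`, then `𝔼 Ψ(B η) ≤ 𝔼 Ψ(A ξ)`. -/
theorem integral_stdGaussian_le_of_trace_le {E₁ E₂ ι₁ ι₂ : Type*}
    [NormedAddCommGroup E₁] [InnerProductSpace ℝ E₁] [FiniteDimensional ℝ E₁]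
    [MeasurableSpace E₁] [BorelSpace E₁] [Fintype ι₁]
    [NormedAddCommGroup E₂] [InnerProductSpace ℝ E₂] [FiniteDimensional ℝ E₂]
    [MeasurableSpace E₂] [BorelSpace E₂] [Fintype ι₂]
    (b₁ : OrthonormalBasis ι₁ ℝ E₁) (b₂ : OrthonormalBasis ι₂ ℝ E₂)
    (A : E₁ →L[ℝ] V) (B : E₂ →L[ℝ] V) {Ψ : V → ℝ} {D : V → V →L[ℝ] ℝ} {D2 : V → V → ℝ} {C : ℝ}
    {C2 : V → ℝ} (hΨ : ∀ z, HasFDerivAt Ψ (D z) z)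
    (hD2 : ∀ z v, HasDerivAt (fun r : ℝ => D (z + r • v) v) (D2 z v) 0)
    (hDc : Continuous D) (hDb : ∀ z, ‖D z‖ ≤ C) (hD2c : ∀ v, Continuous fun z => D2 z v)
    (hD2b : ∀ z v, |D2 z v| ≤ C2 v)
    (hle : ∀ z, ∑ l, D2 z (B (b₂ l)) ≤ ∑ k, D2 z (A (b₁ k))) :
    ∫ y, Ψ (B y) ∂(stdGaussian E₂) ≤ ∫ x, Ψ (A x) ∂(stdGaussian E₁) := by
  set γ₁ := stdGaussian E₁ with hγ₁
  set γ₂ := stdGaussian E₂ with hγ₂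
  have hC0 : 0 ≤ C := (norm_nonneg _).trans (hDb 0)
  have hΨc : Continuous Ψ := continuous_iff_continuousAt.2 fun z => (hΨ z).continuousAt
  set K := ‖A‖ + ‖B‖ with hK
  have hK0 : 0 ≤ K := by positivity
  have hAB : ∀ q : E₁ × E₂, ‖A q.1‖ + ‖B q.2‖ ≤ K * (1 + ‖q‖) := by
    intro q
    have h1 := A.le_opNorm q.1
    have h2 := B.le_opNorm q.2
    have h3 : ‖A‖ * ‖q.1‖ ≤ ‖A‖ * (1 + ‖q‖) := by gcongr; linarith [norm_fst_le q]
    have h4 : ‖B‖ * ‖q.2‖ ≤ ‖B‖ * (1 + ‖q‖) := by gcongr; linarith [norm_snd_le q]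
    rw [hK, add_mul]
    linarith
  set Z : ℝ → E₁ × E₂ → V := fun θ q => Real.sin θ • A q.1 + Real.cos θ • B q.2 with hZ
  have hZc : ∀ θ, Continuous (Z θ) := fun θ => by fun_prop
  set ρ : ℝ → ℝ := fun θ => ∫ q, Ψ (Z θ q) ∂(γ₁.prod γ₂) with hρ
  set G : ℝ → E₁ × E₂ → ℝ := fun θ q =>
    D (Z θ q) (Real.cos θ • A q.1 - Real.sin θ • B q.2) with hG
  have hGb : ∀ θ q, |G θ q| ≤ (C * K) * (1 + ‖q‖) ^ 2 := by
    intro θ q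
    refine ((D _).le_opNorm _).trans ?_
    calc _ ≤ C * (K * (1 + ‖q‖)) := by
          gcongr
          · exact hDb _
          · exact (norm_cos_smul_sub_sin_smul_le θ _ _).trans (hAB q)
      _ = C * K * (1 + ‖q‖) := by ring
      _ ≤ _ := by
          gcongr
          nlinarith [norm_nonneg q]
  have hΨb : ∀ z, |Ψ z| ≤ |Ψ 0| + C * ‖z‖ := by
    intro z
    have h1 := Convex.norm_image_sub_le_of_norm_hasFDerivWithin_le (s := Set.univ) (C := C)
      (𝕜 := ℝ) (f := Ψ) (fun w _ => (hΨ w).hasFDerivWithinAt)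
      (fun w _ => hDb w) convex_univ (Set.mem_univ 0) (Set.mem_univ z)
    rw [sub_zero, Real.norm_eq_abs] at h1
    have := abs_add_le (Ψ 0) (Ψ z - Ψ 0)
    rw [add_sub_cancel] at this
    linarith
  have hρ' : ∀ θ, HasDerivAt ρ (∫ q, G θ q ∂(γ₁.prod γ₂)) θ := by
    intro θ
    refine (hasDerivAt_integral_of_dominated_loc_of_deriv_le (s := Set.univ) Filter.univ_mem
      (bound := fun q => (C * K) * (1 + ‖q‖) ^ 2) (F' := G) ?_ ?_ ?_ ?_ ?_ ?_).2
    · exact Filter.Eventually.of_forall fun t => (hΨc.comp (hZc t)).aestronglyMeasurable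
    · refine integrable_of_quadratic_growth (C := |Ψ 0| + C * K) (hΨc.comp (hZc θ)) fun q => ?_
      refine (hΨb _).trans ?_
      have h1 : ‖Z θ q‖ ≤ K * (1 + ‖q‖) :=
        (norm_sin_smul_add_cos_smul_le θ _ _).trans (hAB q)
      have h2 : C * ‖Z θ q‖ ≤ C * (K * (1 + ‖q‖)) := by gcongr
      have h3 : 1 + ‖q‖ ≤ (1 + ‖q‖) ^ 2 := by nlinarith [norm_nonneg q]
      have h4 : C * K * (1 + ‖q‖) ≤ C * K * (1 + ‖q‖) ^ 2 := by gcongr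
      have h5 : |Ψ 0| * 1 ≤ |Ψ 0| * (1 + ‖q‖) ^ 2 := by
        gcongr
        nlinarith [norm_nonneg q]
      linarith
    · exact (by fun_prop : Continuous (G θ)).aestronglyMeasurable
    · exact Filter.Eventually.of_forall fun q t _ => hGb t q
    · refine integrable_of_quadratic_growth (C := |C * K|) (by fun_prop) fun q => ?_
      rw [abs_mul, abs_of_nonneg (sq_nonneg (1 + ‖q‖))]
    · exact Filter.Eventually.of_forall fun q t _ =>
        (hΨ _).comp_hasDerivAt t (hasDerivAt_sin_smul_add_cos_smul t (A q.1) (B q.2))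
  have iA : ∀ θ, Integrable (fun q : E₁ × E₂ => D (Z θ q) (A q.1)) (γ₁.prod γ₂) := fun θ => by
    refine integrable_of_quadratic_growth (C := C * K) (by fun_prop) fun q => ?_
    refine ((D _).le_opNorm _).trans ?_
    have h3 : 1 + ‖q‖ ≤ (1 + ‖q‖) ^ 2 := by nlinarith [norm_nonneg q]
    calc _ ≤ C * (K * (1 + ‖q‖)) := by
          gcongr
          · exact hDb _
          · linarith [hAB q, norm_nonneg (B q.2)]
      _ = C * K * (1 + ‖q‖) := by ring
      _ ≤ _ := by gcongr
  have iB : ∀ θ, Integrable (fun q : E₁ × E₂ => D (Z θ q) (B q.2)) (γ₁.prod γ₂) := fun θ => by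
    refine integrable_of_quadratic_growth (C := C * K) (by fun_prop) fun q => ?_
    refine ((D _).le_opNorm _).trans ?_
    have h3 : 1 + ‖q‖ ≤ (1 + ‖q‖) ^ 2 := by nlinarith [norm_nonneg q]
    calc _ ≤ C * (K * (1 + ‖q‖)) := by
          gcongr
          · exact hDb _
          · linarith [hAB q, norm_nonneg (A q.1)]
      _ = C * K * (1 + ‖q‖) := by ring
      _ ≤ _ := by gcongr
  have iD : ∀ θ v, Integrable (fun q : E₁ × E₂ => D2 (Z θ q) v) (γ₁.prod γ₂) := fun θ v =>
    integrable_of_quadratic_growth (C := C2 v) ((hD2c v).comp (hZc θ)) fun q =>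
      (hD2b _ _).trans (le_mul_of_one_le_right ((abs_nonneg _).trans (hD2b 0 v))
        (by nlinarith [norm_nonneg q]))
  have iSA : ∀ θ, Integrable (fun q : E₁ × E₂ => ∑ k, D2 (Z θ q) (A (b₁ k))) (γ₁.prod γ₂) :=
    fun θ => integrable_finsetSum _ fun k _ => iD θ _
  have iSB : ∀ θ, Integrable (fun q : E₁ × E₂ => ∑ k, D2 (Z θ q) (B (b₂ k))) (γ₁.prod γ₂) :=
    fun θ => integrable_finsetSum _ fun k _ => iD θ _
  have hGval : ∀ θ, ∫ q, G θ q ∂(γ₁.prod γ₂) = Real.sin θ * Real.cos θ *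
      (∫ q, ∑ k, D2 (Z θ q) (A (b₁ k)) ∂(γ₁.prod γ₂)
        - ∫ q, ∑ k, D2 (Z θ q) (B (b₂ k)) ∂(γ₁.prod γ₂)) := by
    intro θ
    have e0 : ∫ q, G θ q ∂(γ₁.prod γ₂) = Real.cos θ * ∫ q, D (Z θ q) (A q.1) ∂(γ₁.prod γ₂)
        - Real.sin θ * ∫ q, D (Z θ q) (B q.2) ∂(γ₁.prod γ₂) := by
      rw [← integral_const_mul, ← integral_const_mul,
        ← integral_sub ((iA θ).const_mul _) ((iB θ).const_mul _)]
      simp [hG]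
    have eA : ∫ q, D (Z θ q) (A q.1) ∂(γ₁.prod γ₂)
        = Real.sin θ * ∫ q, ∑ k, D2 (Z θ q) (A (b₁ k)) ∂(γ₁.prod γ₂) := by
      rw [integral_prod_symm _ (iA θ), integral_prod_symm _ (iSA θ), ← integral_const_mul]
      congr 1
      ext y
      have := integral_apply_stdGaussian_eq_trace b₁ A hD2 hDc hDb hD2c hD2b
        (Real.cos θ • B y) (Real.sin θ)
      simpa only [hZ, add_comm] using this
    have eB : ∫ q, D (Z θ q) (B q.2) ∂(γ₁.prod γ₂)
        = Real.cos θ * ∫ q, ∑ k, D2 (Z θ q) (B (b₂ k)) ∂(γ₁.prod γ₂) := by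
      rw [integral_prod _ (iB θ), integral_prod _ (iSB θ), ← integral_const_mul]
      congr 1
      ext x
      exact integral_apply_stdGaussian_eq_trace b₂ B hD2 hDc hDb hD2c hD2b
        (Real.sin θ • A x) (Real.cos θ)
    rw [e0, eA, eB]
    ring
  have hmono : MonotoneOn ρ (Set.Icc 0 (Real.pi / 2)) := by
    refine monotoneOn_of_hasDerivWithinAt_nonneg (convex_Icc _ _)
      (f' := fun θ => ∫ q, G θ q ∂(γ₁.prod γ₂)) ?_ ?_ ?_
    · exact fun θ _ => (hρ' θ).continuousAt.continuousWithinAt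
    · exact fun θ _ => (hρ' θ).hasDerivWithinAt
    · intro θ hθ
      rw [interior_Icc] at hθ
      have hc := Real.cos_nonneg_of_neg_pi_div_two_le_of_le
        (by linarith [hθ.1, Real.pi_pos]) hθ.2.le
      have hs := Real.sin_nonneg_of_nonneg_of_le_pi hθ.1.le (by linarith [hθ.2, Real.pi_pos])
      rw [hGval]
      have : ∫ q, ∑ k, D2 (Z θ q) (B (b₂ k)) ∂(γ₁.prod γ₂)
          ≤ ∫ q, ∑ k, D2 (Z θ q) (A (b₁ k)) ∂(γ₁.prod γ₂) :=
        integral_mono (iSB θ) (iSA θ) fun q => hle _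
      exact mul_nonneg (mul_nonneg hs hc) (sub_nonneg.2 this)
  have hfin := hmono (Set.left_mem_Icc.2 (by positivity)) (Set.right_mem_Icc.2 (by positivity))
    (by positivity)
  have r0 : ρ 0 = ∫ y, Ψ (B y) ∂γ₂ := by
    simp only [hρ, hZ, Real.sin_zero, Real.cos_zero, zero_smul, one_smul, zero_add]
    rw [integral_fun_snd (fun y => Ψ (B y))]
    simp
  have r1 : ρ (Real.pi / 2) = ∫ x, Ψ (A x) ∂γ₁ := by
    simp only [hρ, hZ, Real.sin_pi_div_two, Real.cos_pi_div_two, zero_smul, one_smul, add_zero]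
    rw [integral_fun_fst (fun x => Ψ (A x))]
    simp
  rwa [r0, r1] at hfin

end Interpolation

/-! ### Soft minima of perturbed norms -/

section SoftMin

variable {T : Type*} [Fintype T]

/-- The smooth approximation `-β⁻¹ log ∑ₜ exp(-β cₜ)` of `minₜ cₜ`. -/
noncomputable def softMin (β : ℝ) (c : T → ℝ) : ℝ := -β⁻¹ * Real.log (∑ t, Real.exp (-β * c t))

/-- The Gibbs weights, which form the gradient of `softMin β`. -/
noncomputable def gibbsWeight (β : ℝ) (c : T → ℝ) (t : T) : ℝ :=
  Real.exp (-β * c t) / ∑ t', Real.exp (-β * c t')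

lemma sum_exp_pos [Nonempty T] (β : ℝ) (c : T → ℝ) : 0 < ∑ t, Real.exp (-β * c t) :=
  Finset.sum_pos (fun _ _ => Real.exp_pos _) Finset.univ_nonempty

lemma gibbsWeight_nonneg (β : ℝ) (c : T → ℝ) (t : T) : 0 ≤ gibbsWeight β c t :=
  div_nonneg (Real.exp_pos _).le (Finset.sum_nonneg fun _ _ => (Real.exp_pos _).le)

lemma sum_gibbsWeight [Nonempty T] (β : ℝ) (c : T → ℝ) : ∑ t, gibbsWeight β c t = 1 := by
  simp only [gibbsWeight]
  rw [← Finset.sum_div, div_self (sum_exp_pos β c).ne']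

lemma softMin_le {β : ℝ} (hβ : 0 < β) (c : T → ℝ) (t : T) : softMin β c ≤ c t := by
  have h1 : -β * c t ≤ Real.log (∑ t, Real.exp (-β * c t)) := by
    rw [Real.le_log_iff_exp_le (lt_of_lt_of_le (Real.exp_pos (-β * c t))
      (Finset.single_le_sum (f := fun t => Real.exp (-β * c t))
        (fun _ _ => (Real.exp_pos _).le) (Finset.mem_univ t)))]
    exact Finset.single_le_sum (f := fun t => Real.exp (-β * c t))
      (fun _ _ => (Real.exp_pos _).le) (Finset.mem_univ t)
  rw [softMin, neg_mul, neg_le, ← div_eq_inv_mul, le_div_iff₀ hβ]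
  linarith

lemma le_softMin [Nonempty T] {β : ℝ} (hβ : 0 < β) {c : T → ℝ} {m : ℝ} (hm : ∀ t, m ≤ c t) :
    m - Real.log (Fintype.card T) / β ≤ softMin β c := by
  have hcard : (0 : ℝ) < Fintype.card T := by exact_mod_cast Fintype.card_pos
  have h1 : Real.log (∑ t, Real.exp (-β * c t)) ≤ Real.log (Fintype.card T) + -β * m := by
    rw [Real.log_le_iff_le_exp (sum_exp_pos β c), Real.exp_add, Real.exp_log hcard]
    calc ∑ t, Real.exp (-β * c t) ≤ ∑ _t : T, Real.exp (-β * m) := by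
          refine Finset.sum_le_sum fun t _ => Real.exp_le_exp.2 ?_
          nlinarith [hm t]
      _ = _ := by simp
  rw [softMin, neg_mul, ← div_eq_inv_mul, le_neg, neg_sub, div_le_iff₀ hβ, sub_mul,
    div_mul_cancel₀ _ hβ.ne']
  linarith

lemma continuous_gibbsWeight [Nonempty T] (β : ℝ) (t : T) :
    Continuous fun c : T → ℝ => gibbsWeight β c t := by
  unfold gibbsWeight
  exact Continuous.div (by fun_prop) (by fun_prop) fun c => (sum_exp_pos β c).ne'

lemma hasDerivAt_gibbsWeight [Nonempty T] (β : ℝ) {c : ℝ → T → ℝ} {c' : T → ℝ} {r : ℝ}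
    (hc : ∀ t, HasDerivAt (fun r => c r t) (c' t) r) (t : T) :
    HasDerivAt (fun r => gibbsWeight β (c r) t)
      (-β * gibbsWeight β (c r) t * (c' t - ∑ t', gibbsWeight β (c r) t' * c' t')) r := by
  have he : ∀ t, HasDerivAt (fun r => Real.exp (-β * c r t))
      (Real.exp (-β * c r t) * (-β * c' t)) r := fun t => ((hc t).const_mul (-β)).exp
  have hS := HasDerivAt.fun_sum (u := Finset.univ) fun t _ => he t
  have hS0 := (sum_exp_pos β (c r)).ne'
  refine ((he t).fun_div hS hS0).congr_deriv ?_
  have h1 : ∑ t', gibbsWeight β (c r) t' * c' t'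
      = (∑ t', Real.exp (-β * c r t') * c' t') / ∑ t', Real.exp (-β * c r t') := by
    rw [Finset.sum_div]
    exact Finset.sum_congr rfl fun t' _ => by simp only [gibbsWeight]; ring
  have h2 : ∑ t', Real.exp (-β * c r t') * (-β * c' t')
      = -β * ∑ t', Real.exp (-β * c r t') * c' t' := by
    rw [Finset.mul_sum]
    exact Finset.sum_congr rfl fun t' _ => by ring
  rw [h1, h2, gibbsWeight]
  field_simp
  ring

lemma hasFDerivAt_softMin [Nonempty T] {V : Type*} [NormedAddCommGroup V] [NormedSpace ℝ V]
    {β : ℝ} (hβ : 0 < β) {c : V → T → ℝ} {c' : T → V →L[ℝ] ℝ} {x : V}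
    (hc : ∀ t, HasFDerivAt (fun x => c x t) (c' t) x) :
    HasFDerivAt (fun x => softMin β (c x)) (∑ t, gibbsWeight β (c x) t • c' t) x := by
  have hS := HasFDerivAt.fun_sum (u := Finset.univ) fun t _ => ((hc t).const_mul (-β)).exp
  refine ((hS.log (sum_exp_pos β (c x)).ne').const_mul (-β⁻¹)).congr_fderiv ?_
  rw [Finset.smul_sum, Finset.smul_sum]
  refine Finset.sum_congr rfl fun t _ => ?_
  simp only [smul_smul, gibbsWeight]
  congr 1
  field_simp

end SoftMin

section SmoothedMinimum

variable {T W : Type*} [Fintype T] [NormedAddCommGroup W] [InnerProductSpace ℝ W]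

/-- The affinely perturbed norms `√(ε² + ‖aₜ‖²) + bₜ` of a family `(aₜ, bₜ)` in `W × ℝ`. -/
noncomputable def perturbedNorm (ε : ℝ) (z : T → W × ℝ) (t : T) : ℝ :=
  smoothNorm ε (z t).1 + (z t).2

/-- The derivative of `perturbedNorm ε` at `z` in the direction `v`. -/
noncomputable def perturbedNormDeriv (ε : ℝ) (z v : T → W × ℝ) (t : T) : ℝ :=
  inner ℝ (smoothNormGrad ε (z t).1) (v t).1 + (v t).2

/-- The derivative of the soft minimum of the perturbed norms. -/
noncomputable def softMinNormDeriv (β ε : ℝ) (z : T → W × ℝ) : (T → W × ℝ) →L[ℝ] ℝ :=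
  ∑ t, gibbsWeight β (perturbedNorm ε z) t •
    ((innerSL ℝ (smoothNormGrad ε (z t).1)).comp (ContinuousLinearMap.fst ℝ W ℝ)
      + ContinuousLinearMap.snd ℝ W ℝ).comp (ContinuousLinearMap.proj t)

/-- The second derivative, along the direction `v`, of the soft minimum of the perturbed norms. -/
noncomputable def softMinNormSecondDeriv (β ε : ℝ) (z v : T → W × ℝ) : ℝ :=
  ∑ t, gibbsWeight β (perturbedNorm ε z) t *
      inner ℝ (smoothNormHess ε (z t).1 (v t).1) (v t).1
    - β * (∑ t, gibbsWeight β (perturbedNorm ε z) t * perturbedNormDeriv ε z v t ^ 2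
      - (∑ t, gibbsWeight β (perturbedNorm ε z) t * perturbedNormDeriv ε z v t) ^ 2)

omit [Fintype T] [InnerProductSpace ℝ W] in
lemma continuous_perturbedNorm (ε : ℝ) : Continuous (perturbedNorm ε : (T → W × ℝ) → T → ℝ) := by
  unfold perturbedNorm
  have := continuous_smoothNorm (E := W) ε
  fun_prop

omit [Fintype T] in
lemma continuous_perturbedNormDeriv {ε : ℝ} (hε : 0 < ε) (v : T → W × ℝ) (t : T) :
    Continuous fun z => perturbedNormDeriv ε z v t := by
  unfold perturbedNormDeriv
  have := continuous_smoothNormGrad (E := W) hε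
  fun_prop

lemma softMinNormDeriv_apply (β ε : ℝ) (z v : T → W × ℝ) :
    softMinNormDeriv β ε z v
      = ∑ t, gibbsWeight β (perturbedNorm ε z) t * perturbedNormDeriv ε z v t := by
  simp [softMinNormDeriv, perturbedNormDeriv, mul_add]

lemma abs_perturbedNormDeriv_le {ε : ℝ} (hε : 0 < ε) (z v : T → W × ℝ) (t : T) :
    |perturbedNormDeriv ε z v t| ≤ 2 * ‖v‖ := by
  have h1 : ‖v t‖ ≤ ‖v‖ := norm_le_pi_norm v t
  have h2 := norm_fst_le (v t)
  have h3 := norm_snd_le (v t)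
  rw [Real.norm_eq_abs] at h3
  have h4 : |inner ℝ (smoothNormGrad ε (z t).1) (v t).1| ≤ ‖(v t).1‖ :=
    (abs_real_inner_le_norm _ _).trans
      (mul_le_of_le_one_left (norm_nonneg _) (norm_smoothNormGrad_le hε _))
  exact (abs_add_le _ _).trans (by linarith)

lemma abs_sum_gibbsWeight_mul_le [Nonempty T] {β : ℝ} {c f : T → ℝ} {M : ℝ}
    (hf : ∀ t, |f t| ≤ M) : |∑ t, gibbsWeight β c t * f t| ≤ M := by
  refine (Finset.abs_sum_le_sum_abs _ _).trans ?_
  calc ∑ t, |gibbsWeight β c t * f t| ≤ ∑ t, gibbsWeight β c t * M := by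
        refine Finset.sum_le_sum fun t _ => ?_
        rw [abs_mul, abs_of_nonneg (gibbsWeight_nonneg β c t)]
        exact mul_le_mul_of_nonneg_left (hf t) (gibbsWeight_nonneg β c t)
    _ = M := by rw [← Finset.sum_mul, sum_gibbsWeight, one_mul]

lemma norm_softMinNormDeriv_le [Nonempty T] (β : ℝ) {ε : ℝ} (hε : 0 < ε) (z : T → W × ℝ) :
    ‖softMinNormDeriv β ε z‖ ≤ 2 := by
  refine ContinuousLinearMap.opNorm_le_bound _ (by norm_num) fun v => ?_
  rw [softMinNormDeriv_apply]
  exact abs_sum_gibbsWeight_mul_le fun t => abs_perturbedNormDeriv_le hε z v t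

lemma continuous_softMinNormDeriv [Nonempty T] (β : ℝ) {ε : ℝ} (hε : 0 < ε) :
    Continuous (softMinNormDeriv β ε : (T → W × ℝ) → _) := by
  unfold softMinNormDeriv
  refine continuous_finsetSum _ fun t _ => Continuous.fun_smul ?_ ?_
  · exact (continuous_gibbsWeight β t).comp (continuous_perturbedNorm ε)
  · have := continuous_smoothNormGrad (E := W) hε
    fun_prop

lemma hasFDerivAt_softMin_perturbedNorm [Nonempty T] [CompleteSpace W] {β ε : ℝ} (hβ : 0 < β)
    (hε : 0 < ε) (z : T → W × ℝ) :
    HasFDerivAt (fun z => softMin β (perturbedNorm ε z)) (softMinNormDeriv β ε z) z := by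
  refine hasFDerivAt_softMin hβ fun t => ?_
  have h0 : HasFDerivAt (fun w : W × ℝ => smoothNorm ε w.1 + w.2)
      ((innerSL ℝ (smoothNormGrad ε (z t).1)).comp (ContinuousLinearMap.fst ℝ W ℝ)
      + ContinuousLinearMap.snd ℝ W ℝ) (z t) := by
    refine HasFDerivAt.add ?_ (ContinuousLinearMap.snd ℝ W ℝ).hasFDerivAt
    exact (hasGradientAt_smoothNorm hε (z t).1).hasFDerivAt.comp (z t)
      (ContinuousLinearMap.fst ℝ W ℝ).hasFDerivAt
  exact h0.comp z (ContinuousLinearMap.proj (R := ℝ) (φ := fun _ : T => W × ℝ) t).hasFDerivAt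

lemma hasDerivAt_softMinNormDeriv [Nonempty T] (β : ℝ) {ε : ℝ} (hε : 0 < ε) (z v : T → W × ℝ) :
    HasDerivAt (fun r : ℝ => softMinNormDeriv β ε (z + r • v) v)
      (softMinNormSecondDeriv β ε z v) 0 := by
  simp only [softMinNormDeriv_apply]
  have hc : ∀ t, HasDerivAt (fun r : ℝ => perturbedNorm ε (z + r • v) t)
      (perturbedNormDeriv ε z v t) 0 := by
    intro t
    have h1 : HasDerivAt (fun r : ℝ => (z t).1 + r • (v t).1) (v t).1 0 := by
      simpa using ((hasDerivAt_id (0 : ℝ)).smul_const (v t).1).const_add (z t).1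
    have h2 : HasDerivAt (fun r : ℝ => (z t).2 + r * (v t).2) (v t).2 0 := by
      simpa using ((hasDerivAt_id (0 : ℝ)).mul_const (v t).2).const_add (z t).2
    have := (hasDerivAt_smoothNorm hε h1).fun_add h2
    simpa [perturbedNorm, perturbedNormDeriv] using this
  have hd : ∀ t, HasDerivAt (fun r : ℝ => perturbedNormDeriv ε (z + r • v) v t)
      (inner ℝ (smoothNormHess ε (z t).1 (v t).1) (v t).1) 0 := by
    intro t
    have := ((hasDerivAt_smoothNormGrad hε (z t).1 (v t).1).inner ℝ
      (hasDerivAt_const 0 (v t).1)).add_const (v t).2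
    simpa [perturbedNormDeriv] using this
  have hp := hasDerivAt_gibbsWeight β hc
  refine (HasDerivAt.fun_sum (u := Finset.univ) fun t _ => (hp t).fun_mul (hd t)).congr_deriv ?_
  simp only [zero_smul, add_zero, softMinNormSecondDeriv]
  set w := gibbsWeight β (perturbedNorm ε z)
  set q := perturbedNormDeriv ε z v
  set m := ∑ t, w t * q t with hm
  have e : ∑ t, (-β * w t * (q t - m) * q t) = -β * (∑ t, w t * q t ^ 2 - m ^ 2) := by
    have : ∀ t, -β * w t * (q t - m) * q t = -β * (w t * q t ^ 2) + β * m * (w t * q t) :=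
      fun t => by ring
    simp_rw [this]
    rw [Finset.sum_add_distrib, ← Finset.mul_sum, ← Finset.mul_sum, ← hm]
    ring
  rw [Finset.sum_add_distrib, e]
  ring

lemma continuous_smoothNormHess {ε : ℝ} (hε : 0 < ε) (v : W) :
    Continuous fun x : W => smoothNormHess ε x v := by
  unfold smoothNormHess
  have h1 := continuous_smoothNorm (E := W) ε
  refine Continuous.sub (Continuous.smul (h1.inv₀ fun x => (smoothNorm_pos hε x).ne')
    continuous_const) (Continuous.smul (Continuous.div (by fun_prop) (by fun_prop) fun x => ?_)
    continuous_id)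
  exact pow_ne_zero _ (smoothNorm_pos hε x).ne'

lemma abs_inner_smoothNormHess_le {ε : ℝ} (hε : 0 < ε) (x v : W) :
    |inner ℝ (smoothNormHess ε x v) v| ≤ 2 * ‖v‖ ^ 2 / ε := by
  have hN := smoothNorm_pos hε x
  have hεN : ε ≤ smoothNorm ε x := Real.le_sqrt_of_sq_le (by nlinarith [sq_nonneg ‖x‖])
  have hxN := norm_le_smoothNorm ε x
  set N := smoothNorm ε x
  rw [smoothNormHess, inner_sub_left, real_inner_smul_left, real_inner_smul_left,
    real_inner_self_eq_norm_sq]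
  have h1 : |inner ℝ x v / N ^ 3 * inner ℝ x v| ≤ ‖v‖ ^ 2 / ε := by
    rw [div_mul_eq_mul_div, abs_div, abs_mul, abs_of_pos (by positivity : (0:ℝ) < N ^ 3),
      div_le_div_iff₀ (by positivity) hε]
    have h2 : |inner ℝ x v| ≤ N * ‖v‖ := (abs_real_inner_le_norm x v).trans (by gcongr)
    calc |inner ℝ x v| * |inner ℝ x v| * ε ≤ (N * ‖v‖) * (N * ‖v‖) * N := by gcongr
      _ = ‖v‖ ^ 2 * N ^ 3 := by ring
  have h2 : |N⁻¹ * ‖v‖ ^ 2| ≤ ‖v‖ ^ 2 / ε := by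
    rw [abs_of_nonneg (by positivity), mul_comm, ← div_eq_mul_inv]
    gcongr
  calc _ ≤ |N⁻¹ * ‖v‖ ^ 2| + |inner ℝ x v / N ^ 3 * inner ℝ x v| := abs_sub _ _
    _ ≤ ‖v‖ ^ 2 / ε + ‖v‖ ^ 2 / ε := add_le_add h2 h1
    _ = _ := by ring

lemma continuous_softMinNormSecondDeriv [Nonempty T] (β : ℝ) {ε : ℝ} (hε : 0 < ε)
    (v : T → W × ℝ) : Continuous fun z => softMinNormSecondDeriv β ε z v := by
  unfold softMinNormSecondDeriv
  have h1 : ∀ t, Continuous fun z : T → W × ℝ => gibbsWeight β (perturbedNorm ε z) t :=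
    fun t => (continuous_gibbsWeight β t).comp (continuous_perturbedNorm ε)
  have h2 := continuous_perturbedNormDeriv hε v
  have h3 : ∀ t, Continuous fun z : T → W × ℝ => smoothNormHess ε (z t).1 (v t).1 := fun t =>
    (continuous_smoothNormHess hε (v t).1).comp (by fun_prop)
  fun_prop

lemma abs_softMinNormSecondDeriv_le [Nonempty T] {β ε : ℝ} (hβ : 0 < β) (hε : 0 < ε)
    (z v : T → W × ℝ) :
    |softMinNormSecondDeriv β ε z v| ≤ 2 * ‖v‖ ^ 2 / ε + β * (8 * ‖v‖ ^ 2) := by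
  have hv : ∀ t, ‖(v t).1‖ ≤ ‖v‖ := fun t => (norm_fst_le _).trans (norm_le_pi_norm v t)
  have hq := abs_perturbedNormDeriv_le hε z v
  have h1 : |∑ t, gibbsWeight β (perturbedNorm ε z) t *
      inner ℝ (smoothNormHess ε (z t).1 (v t).1) (v t).1| ≤ 2 * ‖v‖ ^ 2 / ε :=
    abs_sum_gibbsWeight_mul_le fun t => (abs_inner_smoothNormHess_le hε _ _).trans (by
      gcongr; exact hv t)
  have h2 : |∑ t, gibbsWeight β (perturbedNorm ε z) t * perturbedNormDeriv ε z v t ^ 2|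
      ≤ (2 * ‖v‖) ^ 2 :=
    abs_sum_gibbsWeight_mul_le fun t => by rw [abs_pow]; gcongr; exact hq t
  have h3 : |(∑ t, gibbsWeight β (perturbedNorm ε z) t * perturbedNormDeriv ε z v t) ^ 2|
      ≤ (2 * ‖v‖) ^ 2 := by
    rw [abs_pow]
    gcongr
    exact abs_sum_gibbsWeight_mul_le hq
  rw [softMinNormSecondDeriv]
  refine (abs_sub _ _).trans (add_le_add h1 ?_)
  rw [abs_mul, abs_of_pos hβ]
  gcongr
  refine (abs_sub _ _).trans ((add_le_add h2 h3).trans_eq ?_)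
  ring

end SmoothedMinimum

/-! ### The trace comparison for Gordon's inequality -/

section Gordon

variable {n p : ℕ}

/-- The linear map `G ↦ G z` on `n × p` matrices, which carry the Frobenius norm. -/
noncomputable def matrixEval (n : ℕ) {p : ℕ} (z : EuclideanSpace ℝ (Fin p)) :
    EuclideanSpace ℝ (Fin n × Fin p) →L[ℝ] EuclideanSpace ℝ (Fin n) :=
  LinearMap.toContinuousLinearMap
    { toFun := fun G => WithLp.toLp 2 fun i => ∑ j, G (i, j) * z j
      map_add' := fun G H => by ext i; simp [add_mul, Finset.sum_add_distrib]
      map_smul' := fun c G => by ext i; simp [Finset.mul_sum, mul_assoc] }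

@[simp]
lemma matrixEval_apply (z : EuclideanSpace ℝ (Fin p)) (G : EuclideanSpace ℝ (Fin n × Fin p))
    (i : Fin n) : matrixEval n z G i = ∑ j, G (i, j) * z j := rfl

lemma norm_matrixEval_le (z : EuclideanSpace ℝ (Fin p)) (G : EuclideanSpace ℝ (Fin n × Fin p)) :
    ‖matrixEval n z G‖ ≤ ‖G‖ * ‖z‖ := by
  refine le_of_sq_le_sq ?_ (by positivity)
  rw [mul_pow, EuclideanSpace.real_norm_sq_eq, EuclideanSpace.real_norm_sq_eq,
    EuclideanSpace.real_norm_sq_eq, Fintype.sum_prod_type, Finset.sum_mul]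
  exact Finset.sum_le_sum fun i _ => by
    rw [matrixEval_apply]
    exact Finset.sum_mul_sq_le_sq_mul_sq _ _ _

lemma matrixEval_single (z : EuclideanSpace ℝ (Fin p)) (i : Fin n) (j : Fin p) :
    matrixEval n z (EuclideanSpace.single (i, j) 1) = z j • EuclideanSpace.single i 1 := by
  ext i'
  by_cases h : i' = i
  · subst h
    simp [Finset.sum_ite_eq']
  · simp [h]

variable {T : Type*} [Fintype T]

/-- The index map of the bilinear process `(G zₜ)ₜ`. -/
noncomputable def bilinearProcess (n : ℕ) {p : ℕ} (z : T → EuclideanSpace ℝ (Fin p)) :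
    EuclideanSpace ℝ (Fin n × Fin p) →L[ℝ] (T → EuclideanSpace ℝ (Fin n) × ℝ) :=
  ContinuousLinearMap.pi fun t => (matrixEval n (z t)).prod 0

/-- The index map of the decoupled process `(g, ⟪h, zₜ⟫)ₜ`. -/
noncomputable def decoupledProcess (n : ℕ) {p : ℕ} (z : T → EuclideanSpace ℝ (Fin p)) :
    WithLp 2 (EuclideanSpace ℝ (Fin n) × EuclideanSpace ℝ (Fin p)) →L[ℝ]
      (T → EuclideanSpace ℝ (Fin n) × ℝ) :=
  ContinuousLinearMap.pi fun t =>
    (WithLp.fstL 2 ℝ _ _).prod ((innerSL ℝ (z t)).comp (WithLp.sndL 2 ℝ _ _))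

lemma smoothNormHess_smul {W : Type*} [NormedAddCommGroup W] [InnerProductSpace ℝ W]
    (ε : ℝ) (x v : W) (c : ℝ) : smoothNormHess ε x (c • v) = c • smoothNormHess ε x v := by
  simp only [smoothNormHess, real_inner_smul_right]
  module

lemma sum_sum_mul_sq {ι : Type*} [Fintype ι] (w : T → ℝ) (f : T → ι → ℝ) :
    ∑ k, (∑ t, w t * f t k) ^ 2 = ∑ t, ∑ t', w t * w t' * ∑ k, f t k * f t' k := by
  simp_rw [pow_two, Finset.sum_mul_sum, Finset.mul_sum]
  rw [Finset.sum_comm]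
  refine Finset.sum_congr rfl fun t _ => ?_
  rw [Finset.sum_comm]
  refine Finset.sum_congr rfl fun t' _ => Finset.sum_congr rfl fun k _ => ?_
  ring

lemma sum_softMinNormSecondDeriv_bilinearProcess (β ε : ℝ) {z : T → EuclideanSpace ℝ (Fin p)}
    (hz : ∀ t, ‖z t‖ = 1) (y : T → EuclideanSpace ℝ (Fin n) × ℝ) :
    ∑ k, softMinNormSecondDeriv β ε y
        (bilinearProcess n z (EuclideanSpace.basisFun (Fin n × Fin p) ℝ k))
      = ∑ t, gibbsWeight β (perturbedNorm ε y) t * ∑ i,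
          inner ℝ (smoothNormHess ε (y t).1 (EuclideanSpace.single i 1)) (EuclideanSpace.single i 1)
        - β * (∑ t, gibbsWeight β (perturbedNorm ε y) t * ‖smoothNormGrad ε (y t).1‖ ^ 2
          - ∑ t, ∑ t', gibbsWeight β (perturbedNorm ε y) t * gibbsWeight β (perturbedNorm ε y) t' *
            (inner ℝ (smoothNormGrad ε (y t).1) (smoothNormGrad ε (y t').1)
              * inner ℝ (z t) (z t'))) := by
  set w := gibbsWeight β (perturbedNorm ε y)
  set N : T → EuclideanSpace ℝ (Fin n) := fun t => smoothNormGrad ε (y t).1 with hN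
  have hb : ∀ (i : Fin n) (j : Fin p) (t : T), bilinearProcess n z
      (EuclideanSpace.basisFun (Fin n × Fin p) ℝ (i, j)) t
        = ((z t j) • EuclideanSpace.single i (1 : ℝ), 0) := by
    intro i j t
    simp [bilinearProcess, matrixEval_single]
  have hzz : ∀ t, ∑ j, z t j ^ 2 = 1 := fun t => by
    rw [← EuclideanSpace.real_norm_sq_eq, hz, one_pow]
  have h1 : ∀ k : Fin n × Fin p, softMinNormSecondDeriv β ε y
      (bilinearProcess n z (EuclideanSpace.basisFun (Fin n × Fin p) ℝ k))
      = ∑ t, w t * (z t k.2 ^ 2 * inner ℝ (smoothNormHess ε (y t).1 (EuclideanSpace.single k.1 1))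
          (EuclideanSpace.single k.1 1))
        - β * (∑ t, w t * (N t k.1 ^ 2 * z t k.2 ^ 2)
          - (∑ t, w t * (N t k.1 * z t k.2)) ^ 2) := by
    rintro ⟨i, j⟩
    have hq : ∀ t, perturbedNormDeriv ε y (bilinearProcess n z
        (EuclideanSpace.basisFun (Fin n × Fin p) ℝ (i, j))) t = N t i * z t j := by
      intro t
      rw [perturbedNormDeriv, hb]
      simp [hN, real_inner_smul_right, EuclideanSpace.inner_single_right, mul_comm]
    rw [softMinNormSecondDeriv]
    simp_rw [hq, hb, smoothNormHess_smul, real_inner_smul_left, real_inner_smul_right, mul_pow]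
    congr 1
    exact Finset.sum_congr rfl fun t _ => by ring
  simp_rw [h1]
  rw [Finset.sum_sub_distrib, ← Finset.mul_sum, Finset.sum_sub_distrib,
    sum_sum_mul_sq w fun t (k : Fin n × Fin p) => N t k.1 * z t k.2, Finset.sum_comm]
  congr 1
  · refine Finset.sum_congr rfl fun t _ => ?_
    rw [← Finset.mul_sum, Fintype.sum_prod_type]
    congr 1
    refine Finset.sum_congr rfl fun i _ => ?_
    dsimp only
    rw [← Finset.sum_mul, hzz, one_mul]
  · congr 2
    · rw [Finset.sum_comm]
      refine Finset.sum_congr rfl fun t _ => ?_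
      rw [← Finset.mul_sum, Fintype.sum_prod_type, EuclideanSpace.real_norm_sq_eq]
      congr 1
      refine Finset.sum_congr rfl fun i _ => ?_
      dsimp only
      rw [← Finset.mul_sum, hzz, mul_one]
    · refine Finset.sum_congr rfl fun t _ => Finset.sum_congr rfl fun t' _ => ?_
      congr 1
      rw [PiLp.inner_apply, PiLp.inner_apply, Finset.sum_mul_sum, Fintype.sum_prod_type]
      refine Finset.sum_congr rfl fun i _ => Finset.sum_congr rfl fun j _ => ?_
      simp
      ring

lemma sum_softMinNormSecondDeriv_decoupledProcess [Nonempty T] (β ε : ℝ)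
    {z : T → EuclideanSpace ℝ (Fin p)}
    (hz : ∀ t, ‖z t‖ = 1) (y : T → EuclideanSpace ℝ (Fin n) × ℝ) :
    ∑ k, softMinNormSecondDeriv β ε y
        (decoupledProcess n z (((EuclideanSpace.basisFun (Fin n) ℝ).prod
          (EuclideanSpace.basisFun (Fin p) ℝ)) k))
      = ∑ t, gibbsWeight β (perturbedNorm ε y) t * ∑ i,
          inner ℝ (smoothNormHess ε (y t).1 (EuclideanSpace.single i 1)) (EuclideanSpace.single i 1)
        - β * (∑ t, gibbsWeight β (perturbedNorm ε y) t * ‖smoothNormGrad ε (y t).1‖ ^ 2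
          - ∑ t, ∑ t', gibbsWeight β (perturbedNorm ε y) t * gibbsWeight β (perturbedNorm ε y) t' *
            inner ℝ (smoothNormGrad ε (y t).1) (smoothNormGrad ε (y t').1))
        - β * (1 - ∑ t, ∑ t', gibbsWeight β (perturbedNorm ε y) t *
            gibbsWeight β (perturbedNorm ε y) t' * inner ℝ (z t) (z t')) := by
  have hw1 : ∑ t, gibbsWeight β (perturbedNorm ε y) t = 1 := sum_gibbsWeight _ _
  set w := gibbsWeight β (perturbedNorm ε y)
  set N : T → EuclideanSpace ℝ (Fin n) := fun t => smoothNormGrad ε (y t).1 with hN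
  have hzz : ∀ t, ∑ j, z t j ^ 2 = 1 := fun t => by
    rw [← EuclideanSpace.real_norm_sq_eq, hz, one_pow]
  have h1 : ∀ i : Fin n, softMinNormSecondDeriv β ε y
      (decoupledProcess n z (((EuclideanSpace.basisFun (Fin n) ℝ).prod
          (EuclideanSpace.basisFun (Fin p) ℝ)) (Sum.inl i)))
      = ∑ t, w t * inner ℝ (smoothNormHess ε (y t).1 (EuclideanSpace.single i 1))
          (EuclideanSpace.single i 1)
        - β * (∑ t, w t * N t i ^ 2 - (∑ t, w t * N t i) ^ 2) := by
    intro i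
    have hb : ∀ t, decoupledProcess n z (((EuclideanSpace.basisFun (Fin n) ℝ).prod
        (EuclideanSpace.basisFun (Fin p) ℝ)) (Sum.inl i)) t
          = (EuclideanSpace.single i (1 : ℝ), 0) := by
      intro t
      simp [decoupledProcess]
    have hq : ∀ t, perturbedNormDeriv ε y (decoupledProcess n z
        (((EuclideanSpace.basisFun (Fin n) ℝ).prod
        (EuclideanSpace.basisFun (Fin p) ℝ)) (Sum.inl i))) t = N t i := by
      intro t
      rw [perturbedNormDeriv, hb]
      simp [hN, EuclideanSpace.inner_single_right]
    rw [softMinNormSecondDeriv]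
    simp_rw [hq, hb]
    rfl
  have h2 : ∀ j : Fin p, softMinNormSecondDeriv β ε y
      (decoupledProcess n z (((EuclideanSpace.basisFun (Fin n) ℝ).prod
          (EuclideanSpace.basisFun (Fin p) ℝ)) (Sum.inr j)))
      = - (β * (∑ t, w t * z t j ^ 2 - (∑ t, w t * z t j) ^ 2)) := by
    intro j
    have hb : ∀ t, decoupledProcess n z (((EuclideanSpace.basisFun (Fin n) ℝ).prod
        (EuclideanSpace.basisFun (Fin p) ℝ)) (Sum.inr j)) t = (0, z t j) := by
      intro t
      simp [decoupledProcess, EuclideanSpace.inner_single_right]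
    have hq : ∀ t, perturbedNormDeriv ε y (decoupledProcess n z
        (((EuclideanSpace.basisFun (Fin n) ℝ).prod
        (EuclideanSpace.basisFun (Fin p) ℝ)) (Sum.inr j))) t = z t j := by
      intro t
      rw [perturbedNormDeriv, hb]
      simp
    rw [softMinNormSecondDeriv]
    simp_rw [hq, hb]
    simp [w]
  rw [Fintype.sum_sum_type]
  simp_rw [h1, h2]
  rw [Finset.sum_sub_distrib, Finset.sum_neg_distrib, ← Finset.mul_sum, ← Finset.mul_sum,
    Finset.sum_sub_distrib, Finset.sum_sub_distrib, sum_sum_mul_sq w fun t i => N t i,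
    sum_sum_mul_sq w fun t j => z t j, ← sub_eq_add_neg]
  have e1 : ∑ i, ∑ t, w t * N t i ^ 2 = ∑ t, w t * ‖N t‖ ^ 2 := by
    rw [Finset.sum_comm]
    refine Finset.sum_congr rfl fun t _ => ?_
    rw [← Finset.mul_sum, EuclideanSpace.real_norm_sq_eq]
  have e2 : ∑ j, ∑ t, w t * z t j ^ 2 = 1 := by
    rw [Finset.sum_comm, ← hw1]
    refine Finset.sum_congr rfl fun t _ => ?_
    rw [← Finset.mul_sum, hzz, mul_one]
  have e3 : ∀ {m : ℕ} (a b : EuclideanSpace ℝ (Fin m)), ∑ k, a k * b k = inner ℝ a b := by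
    intro m a b
    rw [PiLp.inner_apply]
    exact Finset.sum_congr rfl fun k _ => by simp [mul_comm]
  rw [e1, e2]
  simp_rw [e3]
  congr 2
  rw [Finset.sum_comm]
  simp_rw [Finset.mul_sum]

/-- The trace comparison behind Gordon's inequality. The difference of the two sides is
`β ∑ₜ ∑ₜ' wₜ wₜ' (1 - ⟪∇Nₜ, ∇Nₜ'⟫) (1 - ⟪zₜ, zₜ'⟫)`. -/
lemma sum_decoupledProcess_le_sum_bilinearProcess [Nonempty T] {β ε : ℝ} (hβ : 0 < β) (hε : 0 < ε)
    {z : T → EuclideanSpace ℝ (Fin p)} (hz : ∀ t, ‖z t‖ = 1)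
    (y : T → EuclideanSpace ℝ (Fin n) × ℝ) :
    ∑ k, softMinNormSecondDeriv β ε y
        (decoupledProcess n z (((EuclideanSpace.basisFun (Fin n) ℝ).prod
          (EuclideanSpace.basisFun (Fin p) ℝ)) k))
      ≤ ∑ k, softMinNormSecondDeriv β ε y
        (bilinearProcess n z (EuclideanSpace.basisFun (Fin n × Fin p) ℝ k)) := by
  rw [sum_softMinNormSecondDeriv_decoupledProcess β ε hz y,
    sum_softMinNormSecondDeriv_bilinearProcess β ε hz y]
  have hw1 : ∑ t, gibbsWeight β (perturbedNorm ε y) t = 1 := sum_gibbsWeight _ _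
  have hw0 := gibbsWeight_nonneg β (perturbedNorm ε y)
  have hN : ∀ t, ‖smoothNormGrad ε (y t).1‖ ≤ 1 := fun t => norm_smoothNormGrad_le hε _
  set w := gibbsWeight β (perturbedNorm ε y)
  set N : T → EuclideanSpace ℝ (Fin n) := fun t => smoothNormGrad ε (y t).1
  have key : 0 ≤ ∑ t, ∑ t', w t * w t' * ((1 - inner ℝ (N t) (N t')) *
      (1 - inner ℝ (z t) (z t'))) := by
    refine Finset.sum_nonneg fun t _ => Finset.sum_nonneg fun t' _ =>
      mul_nonneg (mul_nonneg (hw0 t) (hw0 t')) (mul_nonneg (sub_nonneg.2 ?_) (sub_nonneg.2 ?_))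
    · exact (real_inner_le_norm _ _).trans (mul_le_one₀ (hN t) (norm_nonneg _) (hN t'))
    · refine (real_inner_le_norm _ _).trans ?_
      rw [hz, hz, one_mul]
  have expand : ∑ t, ∑ t', w t * w t' * ((1 - inner ℝ (N t) (N t')) * (1 - inner ℝ (z t) (z t')))
      = 1 - ∑ t, ∑ t', w t * w t' * inner ℝ (N t) (N t')
        - ∑ t, ∑ t', w t * w t' * inner ℝ (z t) (z t')
        + ∑ t, ∑ t', w t * w t' * (inner ℝ (N t) (N t') * inner ℝ (z t) (z t')) := by
    have h1 : (1 : ℝ) = ∑ t, ∑ t', w t * w t' := by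
      rw [← Finset.sum_mul_sum, hw1, one_mul]
    rw [h1]
    simp only [← Finset.sum_sub_distrib, ← Finset.sum_add_distrib]
    refine Finset.sum_congr rfl fun t _ => Finset.sum_congr rfl fun t' _ => ?_
    rw [← h1]
    ring
  rw [expand] at key
  have := mul_nonneg hβ.le key
  linarith

end Gordon

/-! ### Gordon's inequality and escape for finite sets -/

lemma stdGaussian_prod_map_toLp {E F : Type*} [NormedAddCommGroup E] [InnerProductSpace ℝ E]
    [FiniteDimensional ℝ E] [MeasurableSpace E] [BorelSpace E] [NormedAddCommGroup F]
    [InnerProductSpace ℝ F] [FiniteDimensional ℝ F] [MeasurableSpace F] [BorelSpace F] :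
    ((stdGaussian E).prod (stdGaussian F)).map (WithLp.toLp 2) = stdGaussian (WithLp 2 (E × F)) := by
  have : CompleteSpace E := FiniteDimensional.complete ℝ E
  have : CompleteSpace F := FiniteDimensional.complete ℝ F
  have : IsProbabilityMeasure (((stdGaussian E).prod (stdGaussian F)).map (WithLp.toLp 2)) :=
    Measure.isProbabilityMeasure_map (Measurable.aemeasurable (by fun_prop))
  apply Measure.ext_of_charFun
  ext t
  rw [charFun_prod, charFun_stdGaussian, charFun_stdGaussian, charFun_stdGaussian,
    ← Complex.exp_add]
  congr 1
  have h : ((‖t‖ : ℂ)) ^ 2 = (‖t.ofLp.1‖ : ℂ) ^ 2 + (‖t.ofLp.2‖ : ℂ) ^ 2 := by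
    exact_mod_cast congrArg (fun r : ℝ => (r : ℂ)) (WithLp.prod_norm_sq_eq_of_L2 t)
  rw [h]
  ring

section Escape

variable {n p : ℕ} {T : Type*} [Fintype T] [Nonempty T]

/-- The soft minimum of `t ↦ √(ε² + ‖G zₜ‖²)`. -/
noncomputable def softMinNorm (β ε : ℝ) (z : T → EuclideanSpace ℝ (Fin p))
    (G : EuclideanSpace ℝ (Fin n × Fin p)) : ℝ :=
  softMin β (perturbedNorm ε (bilinearProcess n z G))

omit [Fintype T] [Nonempty T] in
lemma perturbedNorm_bilinearProcess (ε : ℝ) (z : T → EuclideanSpace ℝ (Fin p))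
    (G : EuclideanSpace ℝ (Fin n × Fin p)) (t : T) :
    perturbedNorm ε (bilinearProcess n z G) t = smoothNorm ε (matrixEval n (z t) G) := by
  simp [perturbedNorm, bilinearProcess]

/-- **Gordon's inequality**, smoothed: `min_t ‖G zₜ‖` is on average at least
`𝔼‖g‖ - 𝔼 sup_t ⟪-h, zₜ⟫`. -/
lemma le_integral_softMinNorm {β ε : ℝ} (hβ : 0 < β) (hε : 0 < ε)
    {z : T → EuclideanSpace ℝ (Fin p)} (hz : ∀ t, ‖z t‖ = 1) {M : EuclideanSpace ℝ (Fin p) → ℝ}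
    (hMi : Integrable M (stdGaussian (EuclideanSpace ℝ (Fin p))))
    (hM : ∀ h t, -M h ≤ inner ℝ (z t) h) :
    expectedGaussianLength n - ∫ h, M h ∂(stdGaussian (EuclideanSpace ℝ (Fin p)))
        - Real.log (Fintype.card T) / β
      ≤ ∫ G, softMinNorm β ε z G ∂(stdGaussian (EuclideanSpace ℝ (Fin n × Fin p))) := by
  refine le_trans ?_ (integral_stdGaussian_le_of_trace_le
    (EuclideanSpace.basisFun (Fin n × Fin p) ℝ)
    ((EuclideanSpace.basisFun (Fin n) ℝ).prod (EuclideanSpace.basisFun (Fin p) ℝ))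
    (bilinearProcess n z) (decoupledProcess n z)
    (fun y => hasFDerivAt_softMin_perturbedNorm hβ hε y)
    (fun y v => hasDerivAt_softMinNormDeriv β hε y v) (continuous_softMinNormDeriv β hε)
    (norm_softMinNormDeriv_le β hε) (continuous_softMinNormSecondDeriv β hε)
    (fun y v => abs_softMinNormSecondDeriv_le hβ hε y v)
    (sum_decoupledProcess_le_sum_bilinearProcess hβ hε hz))
  set γn := stdGaussian (EuclideanSpace ℝ (Fin n))
  set γp := stdGaussian (EuclideanSpace ℝ (Fin p))
  have hint : Integrable (fun y => softMin β (perturbedNorm ε (decoupledProcess n z y)))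
      (stdGaussian (WithLp 2 (EuclideanSpace ℝ (Fin n) × EuclideanSpace ℝ (Fin p)))) := by
    set F := fun y : T → EuclideanSpace ℝ (Fin n) × ℝ => softMin β (perturbedNorm ε y) with hF
    have hFd := fun y => hasFDerivAt_softMin_perturbedNorm (T := T)
      (W := EuclideanSpace ℝ (Fin n)) hβ hε y
    have hFc : Continuous F := continuous_iff_continuousAt.2 fun y => (hFd y).continuousAt
    set B := decoupledProcess n z with hB
    refine integrable_of_quadratic_growth (C := |F 0| + 2 * ‖B‖) (hFc.comp B.continuous)
      fun y => ?_
    have h1 := Convex.norm_image_sub_le_of_norm_hasFDerivWithin_le (s := Set.univ) (C := 2)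
      (𝕜 := ℝ) (f := F) (fun w _ => (hFd w).hasFDerivWithinAt)
      (fun w _ => norm_softMinNormDeriv_le β hε w) convex_univ (Set.mem_univ 0)
      (Set.mem_univ (B y))
    rw [sub_zero, Real.norm_eq_abs] at h1
    have h2 := abs_add_le (F 0) (F (B y) - F 0)
    rw [add_sub_cancel] at h2
    have h3 : 2 * ‖B y‖ ≤ 2 * (‖B‖ * ‖y‖) := by gcongr; exact B.le_opNorm y
    have h4 : |F 0| * 1 ≤ |F 0| * (1 + ‖y‖) ^ 2 := by
      gcongr
      nlinarith [norm_nonneg y]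
    have h5 : 2 * ‖B‖ * ‖y‖ ≤ 2 * ‖B‖ * (1 + ‖y‖) ^ 2 := by
      gcongr
      nlinarith [norm_nonneg y]
    calc |F (B y)| ≤ |F 0| + 2 * ‖B‖ * ‖y‖ := by linarith
      _ ≤ _ := by rw [add_mul]; linarith
  have hmeas : Measurable (WithLp.toLp 2 :
      EuclideanSpace ℝ (Fin n) × EuclideanSpace ℝ (Fin p) → _) := by fun_prop
  rw [← stdGaussian_prod_map_toLp] at hint ⊢
  have hint' := hint.comp_measurable hmeas
  rw [integral_map hmeas.aemeasurable hint.aestronglyMeasurable]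
  have i1 : Integrable (fun q : EuclideanSpace ℝ (Fin n) × EuclideanSpace ℝ (Fin p) => ‖q.1‖)
      (γn.prod γp) := integrable_norm_stdGaussian.comp_fst γp
  have i2 : Integrable (fun q : EuclideanSpace ℝ (Fin n) × EuclideanSpace ℝ (Fin p) => M q.2)
      (γn.prod γp) := hMi.comp_snd γn
  have e : ∫ q : EuclideanSpace ℝ (Fin n) × EuclideanSpace ℝ (Fin p),
      (‖q.1‖ - M q.2 - Real.log (Fintype.card T) / β) ∂(γn.prod γp)
      = expectedGaussianLength n - ∫ h, M h ∂γp - Real.log (Fintype.card T) / β := by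
    have i12 : Integrable (fun q : EuclideanSpace ℝ (Fin n) × EuclideanSpace ℝ (Fin p) =>
        ‖q.1‖ - M q.2) (γn.prod γp) := i1.sub i2
    rw [integral_sub i12 (integrable_const _), integral_sub i1 i2,
      integral_fun_fst (fun x : EuclideanSpace ℝ (Fin n) => ‖x‖), integral_fun_snd M]
    simp [expectedGaussianLength, γn]
  rw [← e]
  refine integral_mono ((i1.sub i2).sub (integrable_const _)) hint' fun q => ?_
  refine le_softMin hβ fun t => ?_
  simp only [perturbedNorm, decoupledProcess]
  have h1 := norm_le_smoothNorm ε q.1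
  have h2 := hM q.2 t
  simp
  linarith

/-- Gordon's inequality and concentration, for a finite set of unit vectors. -/
theorem measureReal_exists_norm_matrixEval_le {z : T → EuclideanSpace ℝ (Fin p)}
    (hz : ∀ t, ‖z t‖ = 1) {M : EuclideanSpace ℝ (Fin p) → ℝ}
    (hMi : Integrable M (stdGaussian (EuclideanSpace ℝ (Fin p))))
    (hM : ∀ h t, -M h ≤ inner ℝ (z t) h) {a : ℝ}
    (ha : a < expectedGaussianLength n - ∫ h, M h ∂(stdGaussian (EuclideanSpace ℝ (Fin p)))) :
    (stdGaussian (EuclideanSpace ℝ (Fin n × Fin p))).real {G | ∃ t, ‖matrixEval n (z t) G‖ ≤ a}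
      ≤ Real.exp (-(expectedGaussianLength n
        - ∫ h, M h ∂(stdGaussian (EuclideanSpace ℝ (Fin p))) - a) ^ 2 / 2) := by
  set γ := stdGaussian (EuclideanSpace ℝ (Fin n × Fin p)) with hγ
  set m := expectedGaussianLength n - ∫ h, M h ∂(stdGaussian (EuclideanSpace ℝ (Fin p))) with hm
  set ℓ := Real.log (Fintype.card T) with hℓ
  have hℓ0 : 0 ≤ ℓ := Real.log_nonneg (by exact_mod_cast Fintype.card_pos)
  have key : ∀ δ, 0 < δ → 2 * δ < m - a →
      γ.real {G | ∃ t, ‖matrixEval n (z t) G‖ ≤ a} ≤ Real.exp (-(m - a - 2 * δ) ^ 2 / 2) := by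
    intro δ hδ hδm
    obtain ⟨β, hβ, hβδ⟩ : ∃ β : ℝ, 0 < β ∧ ℓ / β ≤ δ :=
      ⟨(ℓ + 1) / δ, by positivity, by
        rw [div_div_eq_mul_div, div_le_iff₀ (by positivity)]; nlinarith⟩
    set A := bilinearProcess n z with hA
    have hd : ∀ G, HasFDerivAt (softMinNorm (n := n) β δ z)
        ((softMinNormDeriv β δ (A G)).comp A) G := fun G =>
      (hasFDerivAt_softMin_perturbedNorm hβ hδ (A G)).comp G A.hasFDerivAt
    have hcont : Continuous fun G => (softMinNormDeriv β δ (A G)).comp A := by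
      have := continuous_softMinNormDeriv (T := T) (W := EuclideanSpace ℝ (Fin n)) β hδ
      fun_prop
    have hnorm : ∀ G, ‖(softMinNormDeriv β δ (A G)).comp A‖ ≤ 1 := by
      intro G
      refine ContinuousLinearMap.opNorm_le_bound _ zero_le_one fun H => ?_
      rw [ContinuousLinearMap.comp_apply, softMinNormDeriv_apply, one_mul]
      refine abs_sum_gibbsWeight_mul_le fun t => ?_
      have : perturbedNormDeriv δ (A G) (A H) t
          = inner ℝ (smoothNormGrad δ (A G t).1) (matrixEval n (z t) H) := by
        simp [perturbedNormDeriv, hA, bilinearProcess]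
      rw [this]
      refine (abs_real_inner_le_norm _ _).trans ?_
      calc _ ≤ 1 * (‖H‖ * ‖z t‖) := by
            gcongr
            · exact norm_smoothNormGrad_le hδ _
            · exact norm_matrixEval_le _ _
        _ = ‖H‖ := by rw [hz, one_mul, mul_one]
    have hB : ∀ G, -(ℓ / β) ≤ softMinNorm (n := n) β δ z G := by
      intro G
      have := le_softMin hβ (m := 0) (c := perturbedNorm δ (A G)) fun t => by
        rw [hA, perturbedNorm_bilinearProcess]; exact (smoothNorm_pos hδ _).le
      rwa [zero_sub] at this
    have hE := le_integral_softMinNorm (n := n) hβ hδ hz hMi hM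
    rw [← hm, ← hℓ, ← hγ] at hE
    have hconc := measureReal_le_le_exp (F := softMinNorm (n := n) β δ z)
      (gF := fun G => (InnerProductSpace.toDual ℝ _).symm ((softMinNormDeriv β δ (A G)).comp A))
      (fun G => by
        rw [hasGradientAt_iff_hasFDerivAt, LinearIsometryEquiv.apply_symm_apply]; exact hd G)
      ((LinearIsometryEquiv.continuous _).comp hcont)
      (fun G => by rw [LinearIsometryEquiv.norm_map]; exact hnorm G) hB (a := a + δ) (by
        rw [← hγ]; linarith)
    rw [← hγ] at hconc
    calc γ.real {G | ∃ t, ‖matrixEval n (z t) G‖ ≤ a}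
        ≤ γ.real {G | softMinNorm β δ z G ≤ a + δ} := by
          refine measureReal_mono ?_
          rintro G ⟨t, ht⟩
          refine (softMin_le hβ _ t).trans ?_
          rw [perturbedNorm_bilinearProcess]
          exact (smoothNorm_le hδ.le _).trans (by linarith)
      _ ≤ _ := hconc
      _ ≤ _ := by
          refine Real.exp_le_exp.2 ?_
          have h1 : (m - a - 2 * δ) ^ 2 ≤ ((∫ G, softMinNorm β δ z G ∂γ) - (a + δ)) ^ 2 := by
            apply pow_le_pow_left₀ (by linarith)
            linarith
          linarith
  have ht : Filter.Tendsto (fun δ : ℝ => Real.exp (-(m - a - 2 * δ) ^ 2 / 2))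
      (nhdsWithin 0 (Set.Ioi 0)) (nhds (Real.exp (-(m - a - 2 * 0) ^ 2 / 2))) :=
    ((by fun_prop : Continuous fun δ : ℝ => Real.exp (-(m - a - 2 * δ) ^ 2 / 2)).tendsto
      0).mono_left nhdsWithin_le_nhds
  rw [mul_zero, sub_zero] at ht
  refine ge_of_tendsto ht ?_
  have h2 : ∀ᶠ δ : ℝ in nhdsWithin 0 (Set.Ioi 0), δ < (m - a) / 2 :=
    nhdsWithin_le_nhds (Iio_mem_nhds (by linarith))
  filter_upwards [self_mem_nhdsWithin, h2] with δ hδ hδ2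
  exact key δ hδ (by linarith)

end Escape

/-! ### Gaussian width and escape through a mesh -/

section GaussianWidth

variable {p : ℕ} {S : Set (EuclideanSpace ℝ (Fin p))}

lemma bddAbove_inner_image (hS : S ⊆ Metric.sphere 0 1) (g : EuclideanSpace ℝ (Fin p)) :
    BddAbove ((fun z => inner ℝ g z) '' S) := by
  refine ⟨‖g‖, ?_⟩
  rintro _ ⟨z, hz, rfl⟩
  have := real_inner_le_norm g z
  rwa [mem_sphere_zero_iff_norm.1 (hS hz), mul_one] at this

lemma inner_le_supInner (hS : S ⊆ Metric.sphere 0 1) (g : EuclideanSpace ℝ (Fin p))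
    {z : EuclideanSpace ℝ (Fin p)} (hz : z ∈ S) : inner ℝ g z ≤ supInner S g :=
  le_csSup (bddAbove_inner_image hS g) ⟨z, hz, rfl⟩

lemma supInner_le (hne : S.Nonempty) {g : EuclideanSpace ℝ (Fin p)} {c : ℝ}
    (h : ∀ z ∈ S, inner ℝ g z ≤ c) : supInner S g ≤ c :=
  csSup_le (hne.image _) (by rintro _ ⟨z, hz, rfl⟩; exact h z hz)

lemma lipschitzWith_supInner (hS : S ⊆ Metric.sphere 0 1) (hne : S.Nonempty) :
    LipschitzWith 1 (supInner S) := by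
  refine LipschitzWith.of_le_add fun g g' => supInner_le hne fun z hz => ?_
  have h1 := inner_le_supInner hS g' hz
  have h2 := real_inner_le_norm (g - g') z
  rw [mem_sphere_zero_iff_norm.1 (hS hz), mul_one, inner_sub_left, ← dist_eq_norm] at h2
  linarith

lemma abs_supInner_le (hS : S ⊆ Metric.sphere 0 1) (hne : S.Nonempty)
    (g : EuclideanSpace ℝ (Fin p)) : |supInner S g| ≤ ‖g‖ := by
  obtain ⟨z, hz⟩ := hne
  have hz1 := mem_sphere_zero_iff_norm.1 (hS hz)
  refine abs_le.2 ⟨?_, supInner_le ⟨z, hz⟩ fun y hy => ?_⟩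
  · have h1 := inner_le_supInner hS g hz
    have h2 := (abs_le.1 (abs_real_inner_le_norm g z)).1
    rw [hz1, mul_one] at h2
    linarith
  · have := real_inner_le_norm g y
    rwa [mem_sphere_zero_iff_norm.1 (hS hy), mul_one] at this

lemma integrable_supInner (hS : S ⊆ Metric.sphere 0 1) (hne : S.Nonempty) :
    Integrable (supInner S) (stdGaussian (EuclideanSpace ℝ (Fin p))) :=
  integrable_of_quadratic_growth (C := 1) (lipschitzWith_supInner hS hne).continuous fun g =>
    (abs_supInner_le hS hne g).trans (by nlinarith [norm_nonneg g])

lemma stdGaussian_map_neg {E : Type*} [NormedAddCommGroup E] [InnerProductSpace ℝ E]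
    [FiniteDimensional ℝ E] [MeasurableSpace E] [BorelSpace E] :
    (stdGaussian E).map (fun x => -x) = stdGaussian E :=
  stdGaussian_map (LinearIsometryEquiv.neg ℝ (E := E))

lemma integrable_supInner_neg (hS : S ⊆ Metric.sphere 0 1) (hne : S.Nonempty) :
    Integrable (fun g => supInner S (-g)) (stdGaussian (EuclideanSpace ℝ (Fin p))) := by
  have h := integrable_supInner hS hne
  rw [← stdGaussian_map_neg] at h
  exact h.comp_measurable measurable_neg

lemma integral_supInner_neg (hS : S ⊆ Metric.sphere 0 1) (hne : S.Nonempty) :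
    ∫ g, supInner S (-g) ∂(stdGaussian (EuclideanSpace ℝ (Fin p))) = gaussianWidth S := by
  rw [gaussianWidth]
  conv_rhs => rw [← stdGaussian_map_neg]
  rw [integral_map measurable_neg.aemeasurable
    (lipschitzWith_supInner hS hne).continuous.aestronglyMeasurable]

lemma gaussianWidth_nonneg (hS : S ⊆ Metric.sphere 0 1) (hne : S.Nonempty) :
    0 ≤ gaussianWidth S := by
  obtain ⟨z, hz⟩ := hne
  have h0 : ∫ g, inner ℝ g z ∂(stdGaussian (EuclideanSpace ℝ (Fin p))) = 0 := by
    have := integral_strongDual_stdGaussian (E := EuclideanSpace ℝ (Fin p)) (innerSL ℝ z)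
    simpa [real_inner_comm] using this
  rw [← h0]
  refine integral_mono ?_ (integrable_supInner hS ⟨z, hz⟩) fun g => inner_le_supInner hS g hz
  refine integrable_of_quadratic_growth (C := 1) (by fun_prop) fun g => ?_
  have := abs_real_inner_le_norm g z
  rw [mem_sphere_zero_iff_norm.1 (hS hz), mul_one] at this
  nlinarith [norm_nonneg g]

/-- **Gordon's escape through a mesh**: the kernel of a standard Gaussian matrix misses a
subset of the sphere of small Gaussian width. -/
theorem measureReal_exists_matrixEval_eq_zero_le {n : ℕ} (hS : S ⊆ Metric.sphere 0 1)
    (hne : S.Nonempty) (hw : gaussianWidth S < expectedGaussianLength n) :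
    (stdGaussian (EuclideanSpace ℝ (Fin n × Fin p))).real {G | ∃ z ∈ S, matrixEval n z G = 0}
      ≤ Real.exp (-(expectedGaussianLength n - gaussianWidth S) ^ 2 / 2) := by
  set γ := stdGaussian (EuclideanSpace ℝ (Fin n × Fin p)) with hγ
  set m := expectedGaussianLength n - gaussianWidth S with hm
  have hm0 : 0 < m := sub_pos.2 hw
  set κ := ∫ G : EuclideanSpace ℝ (Fin n × Fin p), ‖G‖ ∂γ
  -- On `{‖G‖ ≤ R}` the set `S` may be replaced by a finite net of mesh `R⁻²`.
  have key : ∀ R : ℝ, 0 < R → R⁻¹ < m → γ.real {G | ∃ z ∈ S, matrixEval n z G = 0}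
      ≤ Real.exp (-(m - R⁻¹) ^ 2 / 2) + κ * R⁻¹ := by
    intro R hR hRm
    have htb : TotallyBounded S := (isCompact_sphere _ _).totallyBounded.subset hS
    obtain ⟨N, hNS, hNfin, hcov⟩ := htb.exists_subset
      (Metric.dist_mem_uniformity (show 0 < R⁻¹ ^ 2 by positivity))
    have hNne : N.Nonempty := by
      obtain ⟨z, hz⟩ := hne
      obtain ⟨y, hy, _⟩ := Set.mem_iUnion₂.1 (hcov hz)
      exact ⟨y, hy⟩
    have : Fintype N := hNfin.fintype
    have : Nonempty N := hNne.to_subtype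
    have h1 := measureReal_exists_norm_matrixEval_le (n := n) (T := N) (z := fun t => (t : _))
      (fun t => mem_sphere_zero_iff_norm.1 (hS (hNS t.2))) (M := fun h => supInner S (-h))
      (integrable_supInner_neg hS hne) (fun h t => by
        have := inner_le_supInner hS (-h) (hNS t.2)
        rw [inner_neg_left, real_inner_comm] at this
        linarith) (a := R⁻¹) (by rwa [integral_supInner_neg hS hne])
    rw [integral_supInner_neg hS hne, ← hm, ← hγ] at h1
    have h2 : γ.real {G | R ≤ ‖G‖} ≤ κ * R⁻¹ := by
      have := mul_meas_ge_le_integral_of_nonneg (μ := γ) (f := fun G => ‖G‖)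
        (Filter.Eventually.of_forall fun G => norm_nonneg G) integrable_norm_stdGaussian R
      rw [← div_eq_mul_inv, le_div_iff₀ hR, mul_comm]
      exact this
    refine le_trans ?_ (add_le_add h1 h2)
    refine le_trans (measureReal_mono ?_) (measureReal_union_le _ _)
    rintro G ⟨z, hz, hG⟩
    by_cases hGR : R ≤ ‖G‖
    · exact Or.inr hGR
    · refine Or.inl ?_
      obtain ⟨y, hy, hzy⟩ := Set.mem_iUnion₂.1 (hcov hz)
      refine ⟨⟨y, hy⟩, ?_⟩
      have e : matrixEval n y G = matrixEval n (y - z) G := by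
        have : matrixEval n (y - z) G = matrixEval n y G - matrixEval n z G := by
          ext i
          simp [mul_sub, Finset.sum_sub_distrib]
        rw [this, hG, sub_zero]
      have hzy' : ‖y - z‖ ≤ R⁻¹ ^ 2 := by
        rw [← dist_eq_norm, dist_comm]; exact le_of_lt hzy
      calc ‖matrixEval n y G‖ ≤ ‖G‖ * ‖y - z‖ := by rw [e]; exact norm_matrixEval_le _ _
        _ ≤ R * R⁻¹ ^ 2 := by
            gcongr
            exact (not_le.1 hGR).le
        _ = R⁻¹ := by field_simp
  have ht : Filter.Tendsto (fun R : ℝ => Real.exp (-(m - R⁻¹) ^ 2 / 2) + κ * R⁻¹)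
      Filter.atTop (nhds (Real.exp (-(m - 0) ^ 2 / 2) + κ * 0)) :=
    ((by fun_prop : Continuous fun r : ℝ => Real.exp (-(m - r) ^ 2 / 2) + κ * r).tendsto
      0).comp tendsto_inv_atTop_zero
  rw [mul_zero, sub_zero, add_zero] at ht
  refine ge_of_tendsto ht ?_
  filter_upwards [Filter.eventually_gt_atTop 0,
    tendsto_inv_atTop_zero.eventually (Iio_mem_nhds hm0)] with R hR hRm
  exact key R hR hRm

end GaussianWidth

section GaussianMap

variable {Ω : Type*} [MeasurableSpace Ω] {P : Measure Ω} [IsProbabilityMeasure P] {n p : ℕ}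
  {Φ : Ω → Matrix (Fin n) (Fin p) ℝ}

omit [IsProbabilityMeasure P] in
/-- After rescaling by `√n`, the entries of a Gaussian map form a standard Gaussian vector. -/
lemma IsGaussianMap.map_eq_stdGaussian (hΦ : IsGaussianMap P Φ) (hn : 0 < n) :
    AEMeasurable (fun ω => WithLp.toLp 2 fun ij : Fin n × Fin p => √n * Φ ω ij.1 ij.2) P ∧
    P.map (fun ω => WithLp.toLp 2 fun ij : Fin n × Fin p => √n * Φ ω ij.1 ij.2)
      = stdGaussian (EuclideanSpace ℝ (Fin n × Fin p)) := by
  have hlaw : ∀ ij : Fin n × Fin p,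
      HasLaw (fun ω => √n * Φ ω ij.1 ij.2) (gaussianReal 0 1) P := by
    intro ij
    have h := gaussianReal_const_mul (hΦ.hasLaw ij.1 ij.2) (√n)
    rw [mul_zero] at h
    have hv : NNReal.mk (√(n : ℝ) ^ 2) (sq_nonneg _) * (1 / (n : ℝ≥0)) = 1 := by
      ext
      simp
      rw [mul_inv_cancel₀]
      exact_mod_cast hn.ne'
    rwa [hv] at h
  have hind : iIndepFun (fun (ij : Fin n × Fin p) ω => √n * Φ ω ij.1 ij.2) P :=
    hΦ.indep.comp (fun _ x => √n * x) fun _ => by fun_prop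
  have hae : AEMeasurable (fun ω (ij : Fin n × Fin p) => √n * Φ ω ij.1 ij.2) P :=
    aemeasurable_pi_lambda _ fun ij => (hlaw ij).aemeasurable
  have hm : Measurable (WithLp.toLp 2 : (Fin n × Fin p → ℝ) → _) := by fun_prop
  refine ⟨hm.comp_aemeasurable hae, ?_⟩
  have h1 := hind.map_fun_eq_pi_map fun ij => (hlaw ij).aemeasurable
  simp_rw [(hlaw _).map_eq] at h1
  rw [← map_pi_eq_stdGaussian, ← h1, AEMeasurable.map_map_of_aemeasurable hm.aemeasurable hae]
  rfl

/-- Gordon's escape through a mesh, for Gaussian measurement maps. -/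
theorem IsGaussianMap.measureReal_exists_mulVec_eq_zero_le (hΦ : IsGaussianMap P Φ) (hn : 0 < n)
    {S : Set (EuclideanSpace ℝ (Fin p))} (hS : S ⊆ Metric.sphere 0 1) (hne : S.Nonempty)
    (hw : gaussianWidth S < expectedGaussianLength n) :
    P.real {ω | ∃ z ∈ S, (Φ ω).mulVec z.ofLp = 0}
      ≤ Real.exp (-(1 / 2) * (expectedGaussianLength n - gaussianWidth S) ^ 2) := by
  obtain ⟨hae, hmap⟩ := hΦ.map_eq_stdGaussian hn
  set Y := fun ω => WithLp.toLp 2 fun ij : Fin n × Fin p => √n * Φ ω ij.1 ij.2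
  have h := measureReal_exists_matrixEval_eq_zero_le (n := n) hS hne hw
  rw [neg_div, div_eq_inv_mul, ← one_div, ← neg_mul] at h
  refine le_trans ?_ h
  rw [← hmap]
  refine le_trans (measureReal_mono ?_) (ENNReal.toReal_mono (measure_ne_top _ _)
    (Measure.le_map_apply hae {G | ∃ z ∈ S, matrixEval n z G = 0}))
  rintro ω ⟨z, hz, h0⟩
  refine ⟨z, hz, ?_⟩
  ext i
  have := congrFun h0 i
  simp only [Matrix.mulVec, dotProduct, Pi.zero_apply] at this
  simp [Y, mul_assoc, ← Finset.mul_sum, this]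

end GaussianMap

/-! ### The atomic norm and its tangent cone -/

section AtomicNorm

variable {p : ℕ}

lemma l1Norm_nonneg (x : EuclideanSpace ℝ (Fin p)) : 0 ≤ l1Norm x :=
  Finset.sum_nonneg fun _ _ => abs_nonneg _

lemma l1Norm_pos {x : EuclideanSpace ℝ (Fin p)} (hx : x ≠ 0) : 0 < l1Norm x := by
  obtain ⟨i, hi⟩ : ∃ i, x i ≠ 0 := by
    by_contra! h
    exact hx (by ext i; simpa using h i)
  exact Finset.sum_pos' (fun _ _ => abs_nonneg _) ⟨i, Finset.mem_univ i, abs_pos.2 hi⟩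

lemma l1Norm_smul (c : ℝ) (x : EuclideanSpace ℝ (Fin p)) :
    l1Norm (c • x) = |c| * l1Norm x := by
  simp [l1Norm, abs_mul, Finset.mul_sum]

lemma l1Norm_add_le (x y : EuclideanSpace ℝ (Fin p)) :
    l1Norm (x + y) ≤ l1Norm x + l1Norm y := by
  simp only [l1Norm, ← Finset.sum_add_distrib, PiLp.add_apply]
  exact Finset.sum_le_sum fun i _ => abs_add_le _ _

lemma convex_l1Norm_le_one : Convex ℝ {x : EuclideanSpace ℝ (Fin p) | l1Norm x ≤ 1} := by
  intro x hx y hy a b ha hb hab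
  have hx' : l1Norm x ≤ 1 := hx
  have hy' : l1Norm y ≤ 1 := hy
  have h := l1Norm_add_le (a • x) (b • y)
  rw [l1Norm_smul, l1Norm_smul, abs_of_nonneg ha, abs_of_nonneg hb] at h
  show l1Norm (a • x + b • y) ≤ 1
  nlinarith

lemma l1Norm_le_one_of_mem_sparseAtoms {a : EuclideanSpace ℝ (Fin p)}
    (ha : a ∈ sparseAtoms p) : l1Norm a ≤ 1 := by
  obtain ⟨hsp, hn⟩ := ha
  obtain ⟨i, hi⟩ : ∃ i, a i ≠ 0 := by
    by_contra! h
    have : a = 0 := by ext i; simpa using h i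
    simp [this] at hn
  have h0 : ∀ j, j ≠ i → a j = 0 := by
    intro j hj
    by_contra hne
    exact hj ((Set.ncard_le_one (Set.toFinite _)).1 hsp j hne i hi)
  have h1 : l1Norm a = |a i| :=
    Finset.sum_eq_single i (fun j _ hj => by simp [h0 j hj]) (by simp)
  have h2 : ‖a‖ ^ 2 = a i ^ 2 := by
    rw [EuclideanSpace.real_norm_sq_eq]
    exact Finset.sum_eq_single i (fun j _ hj => by simp [h0 j hj]) (by simp)
  rw [h1]
  rw [hn] at h2
  exact ((sq_eq_sq₀ (abs_nonneg _) zero_le_one).1 (by rw [sq_abs, ← h2])).le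

lemma single_mem_sparseAtoms (i : Fin p) {c : ℝ} (hc : |c| = 1) :
    EuclideanSpace.single i c ∈ sparseAtoms p := by
  refine ⟨?_, by simpa using hc⟩
  rw [IsSparse, Set.ncard_le_one (Set.toFinite _)]
  intro j hj k hk
  have key : ∀ j, (EuclideanSpace.single i c : EuclideanSpace ℝ (Fin p)) j ≠ 0 → j = i := by
    intro j hj
    by_contra hne
    exact hj (by simp [hne])
  rw [key j hj, key k hk]

open scoped Pointwise in
lemma mem_l1Norm_smul_convexHull {x : EuclideanSpace ℝ (Fin p)} (hx : x ≠ 0) :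
    x ∈ l1Norm x • convexHull ℝ (sparseAtoms p) := by
  have hL := l1Norm_pos hx
  set a : Fin p → EuclideanSpace ℝ (Fin p) := fun i =>
    EuclideanSpace.single i (if 0 ≤ x i then 1 else -1) with ha
  have hmem : ∑ i, (|x i| / l1Norm x) • a i ∈ convexHull ℝ (sparseAtoms p) := by
    refine (convex_convexHull ℝ _).sum_mem (fun i _ => by positivity) ?_ fun i _ =>
      subset_convexHull ℝ _ (single_mem_sparseAtoms i (by split_ifs <;> simp))
    rw [← Finset.sum_div]
    exact div_self hL.ne'
  refine ⟨_, hmem, ?_⟩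
  ext j
  simp only [ha, PiLp.smul_apply, WithLp.ofLp_sum, Finset.sum_apply, WithLp.ofLp_smul,
    Pi.smul_apply, smul_eq_mul]
  rw [Finset.sum_eq_single j (fun i _ hij => by simp [hij.symm]) (by simp)]
  simp only [PiLp.single_apply, if_true]
  split_ifs with h
  · rw [abs_of_nonneg h]; field_simp
  · rw [abs_of_neg (not_le.1 h)]; field_simp

/-- The atomic norm induced by the one-sparse unit vectors is the `ℓ₁` norm. -/
lemma atomicNorm_sparseAtoms (x : EuclideanSpace ℝ (Fin p)) :
    atomicNorm (sparseAtoms p) x = l1Norm x := by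
  rcases eq_or_ne x 0 with rfl | hx
  · simp [atomicNorm, l1Norm]
  have hmem := mem_l1Norm_smul_convexHull hx
  refine le_antisymm (gauge_le_of_mem (l1Norm_nonneg x) hmem) ?_
  refine le_csInf ⟨l1Norm x, l1Norm_pos hx, hmem⟩ ?_
  rintro r ⟨hr, y, hy, rfl⟩
  have hr0 : 0 < r := hr
  have h1 : l1Norm y ≤ 1 :=
    convexHull_min (fun a ha => l1Norm_le_one_of_mem_sparseAtoms ha) convex_l1Norm_le_one hy
  show l1Norm (r • y) ≤ r
  rw [l1Norm_smul, abs_of_pos hr0]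
  exact mul_le_of_le_one_right hr0.le h1

end AtomicNorm

section TangentCone

variable {p : ℕ} {x : EuclideanSpace ℝ (Fin p)}

lemma sphericalTangent_subset_sphere (A : Set (EuclideanSpace ℝ (Fin p))) :
    sphericalTangent A x ⊆ Metric.sphere 0 1 := Set.inter_subset_right

lemma normalize_sub_mem_sphericalTangent {z : EuclideanSpace ℝ (Fin p)} (hz : z ≠ x)
    (hle : l1Norm z ≤ l1Norm x) :
    ‖z - x‖⁻¹ • (z - x) ∈ sphericalTangent (sparseAtoms p) x := by
  have hn : ‖z - x‖ ≠ 0 := norm_ne_zero_iff.2 (sub_ne_zero.2 hz)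
  refine ⟨?_, ?_⟩
  · refine (ConvexCone.hull ℝ _).smul_mem (by positivity) (ConvexCone.subset_hull ⟨z, ?_, rfl⟩)
    rwa [atomicNorm_sparseAtoms, atomicNorm_sparseAtoms]
  · rw [mem_sphere_zero_iff_norm, norm_smul, norm_inv, norm_norm, inv_mul_cancel₀ hn]

lemma sphericalTangent_nonempty (hx : x ≠ 0) :
    (sphericalTangent (sparseAtoms p) x).Nonempty :=
  ⟨_, normalize_sub_mem_sphericalTangent (z := 0) hx.symm (by
    simpa [l1Norm] using l1Norm_nonneg x)⟩

/-- If `x` is not the unique minimizer then the kernel of `Φ` meets the spherical tangent set. -/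
lemma exists_mem_sphericalTangent_of_not_isUniqueOptimum {n : ℕ} {Φ : Matrix (Fin n) (Fin p) ℝ}
    (h : ¬ IsUniqueOptimum l1Norm Φ (Φ.mulVec x.ofLp) x) :
    ∃ z ∈ sphericalTangent (sparseAtoms p) x, Φ.mulVec z.ofLp = 0 := by
  simp only [IsUniqueOptimum, true_and, not_forall, not_lt] at h
  obtain ⟨z, hz, hzx, hle⟩ := h
  refine ⟨_, normalize_sub_mem_sphericalTangent hzx hle, ?_⟩
  rw [WithLp.ofLp_smul, WithLp.ofLp_sub, Matrix.mulVec_smul, Matrix.mulVec_sub, ← hz, sub_self,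
    smul_zero]

lemma inner_le_zero_of_mem_atomicTangentCone {u d : EuclideanSpace ℝ (Fin p)}
    (hu : ∀ z, l1Norm z ≤ l1Norm x → inner ℝ u (z - x) ≤ 0)
    (hd : d ∈ atomicTangentCone (sparseAtoms p) x) : inner ℝ u d ≤ 0 := by
  let K : ConvexCone ℝ (EuclideanSpace ℝ (Fin p)) :=
    { carrier := {d | inner ℝ u d ≤ 0}
      smul_mem' := fun c hc y hy => by
        have : inner ℝ u y ≤ 0 := hy
        simpa [real_inner_smul_right] using mul_nonpos_of_nonneg_of_nonpos hc.le this
      add_mem' := fun y hy z hz => by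
        have h1 : inner ℝ u y ≤ 0 := hy
        have h2 : inner ℝ u z ≤ 0 := hz
        simpa [inner_add_right] using add_nonpos h1 h2 }
  have hle : ConvexCone.hull ℝ {d | ∃ z, atomicNorm (sparseAtoms p) z ≤
      atomicNorm (sparseAtoms p) x ∧ d = z - x} ≤ K := by
    refine ConvexCone.hull_min ?_
    rintro _ ⟨z, hz, rfl⟩
    rw [atomicNorm_sparseAtoms, atomicNorm_sparseAtoms] at hz
    exact hu z hz
  exact hle hd

/-- The point of `t ∂‖x‖₁` nearest to `g`: it equals `t sign(xᵢ)` on the support of `x`, and off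
the support it truncates `gᵢ` to `[-t, t]`. -/
noncomputable def nearestSubgradient (x : EuclideanSpace ℝ (Fin p)) (t : ℝ)
    (g : EuclideanSpace ℝ (Fin p)) : EuclideanSpace ℝ (Fin p) :=
  WithLp.toLp 2 fun i => if x i = 0 then max (-t) (min t (g i)) else t * SignType.sign (x i)

lemma inner_nearestSubgradient_sub_le {t : ℝ} (ht : 0 ≤ t) (g : EuclideanSpace ℝ (Fin p))
    {z : EuclideanSpace ℝ (Fin p)} (hz : l1Norm z ≤ l1Norm x) :
    inner ℝ (nearestSubgradient x t g) (z - x) ≤ 0 := by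
  have habs : ∀ i, |nearestSubgradient x t g i| ≤ t := by
    intro i
    simp only [nearestSubgradient]
    split_ifs with h
    · rw [abs_le]
      exact ⟨le_max_left _ _, max_le (by linarith) (min_le_left _ _)⟩
    · rw [abs_mul, abs_of_nonneg ht]
      refine mul_le_of_le_one_right ht ?_
      rcases lt_trichotomy (x i) 0 with h1 | h1 | h1
      · simp [sign_neg h1]
      · exact absurd h1 h
      · simp [sign_pos h1]
  have h1 : inner ℝ (nearestSubgradient x t g) z ≤ t * l1Norm z := by
    rw [PiLp.inner_apply, l1Norm, Finset.mul_sum]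
    refine Finset.sum_le_sum fun i _ => ?_
    have : nearestSubgradient x t g i * z i ≤ t * |z i| :=
      (le_abs_self _).trans (by rw [abs_mul]; gcongr; exact habs i)
    simpa [mul_comm] using this
  have h2 : inner ℝ (nearestSubgradient x t g) x = t * l1Norm x := by
    rw [PiLp.inner_apply, l1Norm, Finset.mul_sum]
    refine Finset.sum_congr rfl fun i _ => ?_
    simp only [nearestSubgradient]
    by_cases h : x i = 0
    · simp [h]
    · have hs := sign_mul_self (x i)
      simp only [if_neg h, Real.inner_apply, ← hs]
      ring
  rw [inner_sub_right, h2]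
  nlinarith [mul_le_mul_of_nonneg_left hz ht]

lemma supInner_sphericalTangent_le (hx : x ≠ 0) {t : ℝ} (ht : 0 ≤ t)
    (g : EuclideanSpace ℝ (Fin p)) :
    supInner (sphericalTangent (sparseAtoms p) x) g ≤ ‖g - nearestSubgradient x t g‖ := by
  refine supInner_le (sphericalTangent_nonempty hx) fun z hz => ?_
  have h1 := inner_le_zero_of_mem_atomicTangentCone
    (fun _ h => inner_nearestSubgradient_sub_le ht g h) hz.1
  have h2 := real_inner_le_norm (g - nearestSubgradient x t g) z
  rw [mem_sphere_zero_iff_norm.1 hz.2, mul_one, inner_sub_left] at h2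
  linarith

end TangentCone

/-! ### The Gaussian width of the tangent cone -/

section SoftThreshold

/-- The second moment `𝔼(|g| - t)₊²` of the soft-thresholded standard Gaussian variable, written
as the mean squared distance of `g` to `[-t, t]`. -/
noncomputable def thresholdMoment (t : ℝ) : ℝ :=
  ∫ y, (y - max (-t) (min t y)) ^ 2 ∂(gaussianReal 0 1)

lemma integrable_sq_gaussianReal : Integrable (fun y : ℝ => y ^ 2) (gaussianReal 0 1) :=
  integrable_of_quadratic_growth (C := 1) (by fun_prop) fun y => by
    rw [abs_pow, one_mul, Real.norm_eq_abs]
    gcongr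
    linarith

lemma integral_sq_gaussianReal : ∫ y : ℝ, y ^ 2 ∂(gaussianReal 0 1) = 1 := by
  have := variance_fun_id_gaussianReal (μ := 0) (v := 1)
  rw [variance_eq_integral (by fun_prop)] at this
  simpa using this

lemma sub_clamp_sq_le {t : ℝ} (ht : 0 ≤ t) (y : ℝ) :
    (y - max (-t) (min t y)) ^ 2 ≤ y ^ 2 := by
  rw [sq_le_sq, abs_le]
  rcases le_total y t with h1 | h1
  · rw [min_eq_right h1]
    rcases le_total (-t) y with h2 | h2
    · rw [max_eq_right h2]; simp
    · rw [max_eq_left h2, abs_of_nonpos (by linarith)]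
      constructor <;> linarith
  · rw [min_eq_left h1, max_eq_right (by linarith), abs_of_nonneg (by linarith)]
    constructor <;> linarith

lemma integrable_sub_clamp_sq {t : ℝ} (ht : 0 ≤ t) :
    Integrable (fun y : ℝ => (y - max (-t) (min t y)) ^ 2) (gaussianReal 0 1) :=
  integrable_sq_gaussianReal.mono' (by fun_prop : Continuous fun y : ℝ =>
    (y - max (-t) (min t y)) ^ 2).aestronglyMeasurable (Filter.Eventually.of_forall fun y => by
      rw [Real.norm_of_nonneg (sq_nonneg _)]; exact sub_clamp_sq_le ht y)

lemma thresholdMoment_le_one {t : ℝ} (ht : 0 ≤ t) : thresholdMoment t ≤ 1 := by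
  rw [← integral_sq_gaussianReal]
  exact integral_mono (integrable_sub_clamp_sq ht) integrable_sq_gaussianReal
    fun y => sub_clamp_sq_le ht y

lemma mul_exp_neg_sq_div_two_le (u : ℝ) :
    u * Real.exp (-u ^ 2 / 2) ≤ Real.exp (-1 / 2) := by
  have h1 : u ≤ Real.exp ((u ^ 2 - 1) / 2) := by
    have := Real.add_one_le_exp ((u ^ 2 - 1) / 2)
    nlinarith [sq_nonneg (u - 1)]
  calc u * Real.exp (-u ^ 2 / 2) ≤ Real.exp ((u ^ 2 - 1) / 2) * Real.exp (-u ^ 2 / 2) := by gcongr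
    _ = Real.exp (-1 / 2) := by rw [← Real.exp_add]; congr 1; ring

lemma integral_Ioi_mul_exp_neg_mul {t : ℝ} (ht : 0 < t) :
    ∫ u in Set.Ioi (0 : ℝ), u * Real.exp (-(t * u)) = (t ^ 2)⁻¹ := by
  have h := Real.integral_rpow_mul_exp_neg_mul_Ioi (a := 2) (r := t) (by norm_num) ht
  have h2 : Real.Gamma 2 = 1 := Real.Gamma_two
  rw [h2, mul_one] at h
  have e : ∫ u in Set.Ioi (0 : ℝ), u * Real.exp (-(t * u))
      = ∫ u in Set.Ioi (0 : ℝ), u ^ ((2 : ℝ) - 1) * Real.exp (-(t * u)) := by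
    refine setIntegral_congr_fun measurableSet_Ioi fun u _ => ?_
    norm_num
  rw [e, h]
  norm_num

/-- Tail bound for the thresholded second moment. For `y = t + u` with `u > 0` the density factors
as `φ(t) exp(-t u) exp(-u² / 2)`, and `u exp(-u² / 2) ≤ exp(-1 / 2)`. -/
lemma thresholdMoment_le {t : ℝ} (ht : 0 < t) :
    thresholdMoment t
      ≤ 2 * ((√(2 * Real.pi))⁻¹ * Real.exp (-t ^ 2 / 2) * Real.exp (-1 / 2)) * (t ^ 2)⁻¹ := by
  set f : ℝ → ℝ := fun y => max 0 (y - t) ^ 2 with hf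
  have hfc : Continuous f := by fun_prop
  have hfi : Integrable f (gaussianReal 0 1) :=
    integrable_sq_gaussianReal.mono' hfc.aestronglyMeasurable
      (Filter.Eventually.of_forall fun y => by
        rw [Real.norm_of_nonneg (sq_nonneg _), sq_le_sq, abs_of_nonneg (le_max_left _ _)]
        exact max_le (abs_nonneg _) ((by linarith : y - t ≤ y).trans (le_abs_self y)))
  have hneg : (gaussianReal 0 1).map (fun y => -y) = gaussianReal 0 1 := by
    rw [gaussianReal_map_neg, neg_zero]
  have hfi' : Integrable (fun y => f (-y)) (gaussianReal 0 1) := by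
    rw [← hneg] at hfi
    exact hfi.comp_measurable measurable_neg
  have hsplit : ∀ y : ℝ, (y - max (-t) (min t y)) ^ 2 = f y + f (-y) := by
    intro y
    simp only [hf]
    rcases le_total y t with h1 | h1
    · rw [min_eq_right h1, max_eq_left (by linarith : y - t ≤ 0)]
      rcases le_total (-t) y with h2 | h2
      · rw [max_eq_right h2, max_eq_left (by linarith)]; simp
      · rw [max_eq_left h2, max_eq_right (by linarith)]; ring
    · rw [min_eq_left h1, max_eq_right (by linarith), max_eq_right (by linarith),
        max_eq_left (by linarith)]; ring
  have h1 : thresholdMoment t = 2 * ∫ y, f y ∂(gaussianReal 0 1) := by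
    rw [thresholdMoment]
    simp_rw [hsplit]
    rw [integral_add hfi hfi', two_mul]
    congr 1
    conv_rhs => rw [← hneg]
    rw [integral_map measurable_neg.aemeasurable hfc.aestronglyMeasurable]
  set c := (√(2 * Real.pi))⁻¹ * Real.exp (-t ^ 2 / 2) * Real.exp (-1 / 2) with hc
  have hc0 : 0 ≤ c := by positivity
  set k : ℝ → ℝ := (Set.Ioi (0 : ℝ)).indicator fun u => u * Real.exp (-(t * u)) with hk
  have hkint : ∫ u, k u = (t ^ 2)⁻¹ := by
    rw [hk, integral_indicator measurableSet_Ioi, integral_Ioi_mul_exp_neg_mul ht]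
  have hki : Integrable k := Integrable.of_integral_ne_zero (by rw [hkint]; positivity)
  have hle : ∀ y, f y * gaussianPDFReal 0 1 y ≤ c * k (y - t) := by
    intro y
    rcases le_or_gt y t with h | h
    · have e1 : f y = 0 := by simp [hf, max_eq_left (by linarith : y - t ≤ 0)]
      have e2 : k (y - t) = 0 :=
        Set.indicator_of_notMem (by simp only [Set.mem_Ioi]; linarith) _
      rw [e1, e2]; simp
    · have hu : 0 < y - t := sub_pos.2 h
      have e2 : k (y - t) = (y - t) * Real.exp (-(t * (y - t))) :=
        Set.indicator_of_mem (Set.mem_Ioi.2 hu) _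
      have e1 : f y = (y - t) ^ 2 := by simp [hf, max_eq_right hu.le]
      have e3 : gaussianPDFReal 0 1 y = (√(2 * Real.pi))⁻¹ * Real.exp (-t ^ 2 / 2) *
          (Real.exp (-(t * (y - t))) * Real.exp (-(y - t) ^ 2 / 2)) := by
        simp only [gaussianPDFReal, NNReal.coe_one, mul_one, sub_zero]
        rw [mul_assoc, ← Real.exp_add, ← Real.exp_add]
        congr 2
        ring
      rw [e1, e2, e3, hc]
      have h3 := mul_exp_neg_sq_div_two_le (y - t)
      calc _ = ((√(2 * Real.pi))⁻¹ * Real.exp (-t ^ 2 / 2) * ((y - t) *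
            Real.exp (-(t * (y - t))))) * ((y - t) * Real.exp (-(y - t) ^ 2 / 2)) := by ring
        _ ≤ ((√(2 * Real.pi))⁻¹ * Real.exp (-t ^ 2 / 2) * ((y - t) *
            Real.exp (-(t * (y - t))))) * Real.exp (-1 / 2) := by gcongr
        _ = _ := by ring
  have hfint : ∫ y, f y ∂(gaussianReal 0 1) ≤ c * (t ^ 2)⁻¹ := by
    rw [integral_gaussianReal_eq_integral_smul one_ne_zero, ← hkint,
      ← integral_sub_right_eq_self k t, ← integral_const_mul]
    refine integral_mono ?_ ((hki.comp_sub_right t).const_mul c) fun y => ?_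
    · have := integrable_gaussianReal_iff.1 hfi
      simpa only [smul_eq_mul, mul_comm] using this
    · rw [smul_eq_mul, mul_comm]; exact hle y
  rw [h1, mul_assoc]
  linarith

end SoftThreshold

section WidthBound

variable {p : ℕ}

lemma integral_eval_stdGaussian {f : ℝ → ℝ} (hf : Continuous f) (i : Fin p) :
    ∫ g : EuclideanSpace ℝ (Fin p), f (g i) ∂(stdGaussian (EuclideanSpace ℝ (Fin p)))
      = ∫ y, f y ∂(gaussianReal 0 1) := by
  have hm : Measurable (WithLp.toLp 2 : (Fin p → ℝ) → _) := by fun_prop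
  rw [← map_pi_eq_stdGaussian, integral_map hm.aemeasurable
    (by fun_prop : Continuous fun g : EuclideanSpace ℝ (Fin p) => f (g i)).aestronglyMeasurable]
  have h := measurePreserving_eval (fun _ : Fin p => gaussianReal 0 1) i
  have h2 := integral_map (μ := Measure.pi fun _ : Fin p => gaussianReal 0 1) (f := f)
    h.measurable.aemeasurable hf.aestronglyMeasurable
  rw [h.map_eq] at h2
  rw [h2]

lemma continuous_nearestSubgradient (x : EuclideanSpace ℝ (Fin p)) (t : ℝ) :
    Continuous (nearestSubgradient x t) := by
  unfold nearestSubgradient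
  refine (PiLp.continuous_toLp 2 _).comp (continuous_pi fun i => ?_)
  by_cases h : x i = 0
  · simp only [if_pos h]; fun_prop
  · simp only [if_neg h]; fun_prop

lemma sq_integral_le_integral_sq {Ω : Type*} [MeasurableSpace Ω] {μ : Measure Ω}
    [IsProbabilityMeasure μ] {f : Ω → ℝ} (hf : MemLp f 2 μ) :
    (∫ ω, f ω ∂μ) ^ 2 ≤ ∫ ω, f ω ^ 2 ∂μ := by
  have h := variance_eq_sub hf
  have h2 := variance_nonneg f μ
  rw [h] at h2
  simpa using h2

/-- The Gaussian width is controlled by the mean squared distance to `t ∂‖x‖₁`. -/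
lemma gaussianWidth_sq_le_of_threshold {s : ℕ} {x : EuclideanSpace ℝ (Fin p)}
    (hx : x ≠ 0) (hs : IsSparse s x) {t : ℝ} (ht : 0 ≤ t) :
    gaussianWidth (sphericalTangent (sparseAtoms p) x) ^ 2
      ≤ s * (1 + t ^ 2) + ((p : ℝ) - s) * thresholdMoment t := by
  set γ := stdGaussian (EuclideanSpace ℝ (Fin p)) with hγ
  set D : EuclideanSpace ℝ (Fin p) → EuclideanSpace ℝ (Fin p) :=
    fun g => g - nearestSubgradient x t g with hD
  have hDc : Continuous D := continuous_id.sub (continuous_nearestSubgradient x t)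
  have hsub := sphericalTangent_subset_sphere (x := x) (sparseAtoms p)
  have hne := sphericalTangent_nonempty hx
  have hcoord : ∀ i, Integrable (fun g => D g i ^ 2) γ ∧ ∫ g, D g i ^ 2 ∂γ
      = if x i = 0 then thresholdMoment t else 1 + t ^ 2 := by
    intro i
    by_cases h : x i = 0
    · have e : ∀ g, D g i ^ 2 = (g i - max (-t) (min t (g i))) ^ 2 := fun g => by
        simp [hD, nearestSubgradient, h]
      simp_rw [e, if_pos h]
      refine ⟨?_, integral_eval_stdGaussian
        (f := fun y => (y - max (-t) (min t y)) ^ 2) (by fun_prop) i⟩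
      refine integrable_of_quadratic_growth (C := 1) (by fun_prop) fun g => ?_
      rw [abs_of_nonneg (sq_nonneg _), one_mul]
      refine (sub_clamp_sq_le ht (g i)).trans ?_
      rw [← sq_abs]
      gcongr
      have := PiLp.norm_apply_le g i
      rw [Real.norm_eq_abs] at this
      linarith
    · have e : ∀ g, D g i ^ 2 = (g i - t * SignType.sign (x i)) ^ 2 := fun g => by
        simp [hD, nearestSubgradient, h]
      have hsg : (SignType.sign (x i) : ℝ) ^ 2 = 1 := by
        rcases lt_trichotomy (x i) 0 with h1 | h1 | h1
        · simp [sign_neg h1]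
        · exact absurd h1 h
        · simp [sign_pos h1]
      set σ : ℝ := (SignType.sign (x i) : ℝ)
      have e2 : ∀ y : ℝ, (y - t * σ) ^ 2 = y ^ 2 - (2 * t * σ) * y + t ^ 2 := fun y => by
        linear_combination t ^ 2 * hsg
      simp_rw [e, if_neg h]
      refine ⟨?_, ?_⟩
      · refine integrable_of_quadratic_growth (C := (1 + t * |σ|) ^ 2) (by fun_prop) fun g => ?_
        rw [abs_pow, ← mul_pow]
        gcongr
        have h1 := PiLp.norm_apply_le g i
        rw [Real.norm_eq_abs] at h1
        have h2 : |g i - t * σ| ≤ |g i| + |t * σ| := abs_sub _ _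
        rw [abs_mul, abs_of_nonneg ht] at h2
        nlinarith [norm_nonneg g, mul_nonneg (mul_nonneg ht (abs_nonneg σ)) (norm_nonneg g)]
      · rw [integral_eval_stdGaussian (f := fun y => (y - t * σ) ^ 2) (by fun_prop) i]
        simp_rw [e2]
        have hid : Integrable (fun y : ℝ => y) (gaussianReal 0 1) := IsGaussian.integrable_id
        have i1 : Integrable (fun y : ℝ => y ^ 2 - 2 * t * σ * y) (gaussianReal 0 1) :=
          integrable_sq_gaussianReal.sub (hid.const_mul _)
        rw [integral_add i1 (integrable_const _),
          integral_sub integrable_sq_gaussianReal (hid.const_mul _), integral_const_mul,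
          integral_sq_gaussianReal, integral_id_gaussianReal]
        simp
  have hnorm : ∀ g, ‖D g‖ ^ 2 = ∑ i, D g i ^ 2 := fun g => EuclideanSpace.real_norm_sq_eq _
  have hi2 : Integrable (fun g => ‖D g‖ ^ 2) γ := by
    simp_rw [hnorm]
    exact integrable_finsetSum _ fun i _ => (hcoord i).1
  have hLp : MemLp (fun g => ‖D g‖) 2 γ :=
    (memLp_two_iff_integrable_sq hDc.norm.aestronglyMeasurable).2 hi2
  have hw0 := gaussianWidth_nonneg hsub hne
  have hw1 : gaussianWidth (sphericalTangent (sparseAtoms p) x) ≤ ∫ g, ‖D g‖ ∂γ :=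
    integral_mono (integrable_supInner hsub hne) (hLp.integrable (by norm_num))
      fun g => supInner_sphericalTangent_le hx ht g
  set k := (Finset.univ.filter fun i => x i ≠ 0).card with hk
  have hks : k ≤ s := by
    have : ((Finset.univ.filter fun i => x i ≠ 0 : Finset (Fin p)) : Set (Fin p))
        = {i | x i ≠ 0} := by ext; simp
    rw [hk, ← Set.ncard_coe_finset, this]
    exact hs
  have hsum : ∫ g, ‖D g‖ ^ 2 ∂γ = k * (1 + t ^ 2) + ((p : ℝ) - k) * thresholdMoment t := by
    simp_rw [hnorm]
    rw [integral_finsetSum _ fun i _ => (hcoord i).1]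
    simp_rw [fun i => (hcoord i).2]
    have e : ∀ i, (if x i = 0 then thresholdMoment t else 1 + t ^ 2)
        = thresholdMoment t + if x i ≠ 0 then (1 + t ^ 2 - thresholdMoment t) else 0 := by
      intro i
      by_cases h : x i = 0 <;> simp [h]
    simp_rw [e]
    rw [Finset.sum_add_distrib, ← Finset.sum_filter]
    simp only [Finset.sum_const, Finset.card_univ, Fintype.card_fin, nsmul_eq_mul, ← hk]
    ring
  have hth := thresholdMoment_le_one ht
  have hks' : (k : ℝ) ≤ s := by exact_mod_cast hks
  calc gaussianWidth (sphericalTangent (sparseAtoms p) x) ^ 2 ≤ (∫ g, ‖D g‖ ∂γ) ^ 2 := by gcongr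
    _ ≤ ∫ g, ‖D g‖ ^ 2 ∂γ := sq_integral_le_integral_sq hLp
    _ = k * (1 + t ^ 2) + ((p : ℝ) - k) * thresholdMoment t := hsum
    _ ≤ _ := by nlinarith [sq_nonneg t]

lemma four_lt_exp_half_mul_sqrt_two_pi : 4 < Real.exp (1 / 2) * √(2 * Real.pi) := by
  have h1 : Real.exp (1 / 2) * √(2 * Real.pi) = √(Real.exp 1 * (2 * Real.pi)) := by
    rw [Real.sqrt_mul (Real.exp_pos _).le, ← Real.exp_half]
  rw [h1]
  refine Real.lt_sqrt_of_sq_lt ?_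
  nlinarith [Real.exp_one_gt_d9, Real.pi_gt_d2]

/-- The width bound, from the threshold `t² = 2 log(p / s)`. It is strict because `2 π e > 16`, which
leaves room for a strict comparison with the mean Gaussian length. -/
lemma gaussianWidth_sq_lt {s : ℕ} (hsp : s ≤ p) (hs0 : 0 < s) {x : EuclideanSpace ℝ (Fin p)}
    (hx : x ≠ 0) (hs : IsSparse s x) :
    gaussianWidth (sphericalTangent (sparseAtoms p) x) ^ 2
      < 2 * (s : ℝ) * Real.log ((p : ℝ) / (s : ℝ)) + 5 / 4 * (s : ℝ) := by
  have hs' : (0 : ℝ) < s := by exact_mod_cast hs0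
  rcases hsp.eq_or_lt with rfl | hlt
  · have h := gaussianWidth_sq_le_of_threshold hx hs (t := 0) le_rfl
    rw [div_self hs'.ne', Real.log_one]
    simp only [ne_eq, OfNat.ofNat_ne_zero, not_false_eq_true, zero_pow, add_zero, mul_one, sub_self,
      zero_mul] at h
    linarith
  have hp' : (s : ℝ) < p := by exact_mod_cast hlt
  have hp0 : (0 : ℝ) < p := hs'.trans hp'
  set ℓ := Real.log ((p : ℝ) / s) with hℓ
  have hℓ0 : 0 < ℓ := Real.log_pos (by rwa [one_lt_div hs'])
  have ht0 : 0 < √(2 * ℓ) := Real.sqrt_pos.2 (by positivity)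
  have ht2 : √(2 * ℓ) ^ 2 = 2 * ℓ := Real.sq_sqrt (by positivity)
  have h := gaussianWidth_sq_le_of_threshold hx hs ht0.le
  have hth := thresholdMoment_le ht0
  have hexp : Real.exp (-√(2 * ℓ) ^ 2 / 2) = s / p := by
    rw [neg_div, ht2, mul_div_cancel_left₀ _ two_ne_zero, Real.exp_neg, hℓ,
      Real.exp_log (by positivity), inv_div]
  rw [hexp, ht2] at hth
  set c := (√(2 * Real.pi))⁻¹ * Real.exp (-1 / 2) with hc
  have hc0 : 0 < c := by positivity
  have hc4 : c < 1 / 4 := by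
    have e : c = (Real.exp (1 / 2) * √(2 * Real.pi))⁻¹ := by
      rw [hc, mul_inv, ← Real.exp_neg, mul_comm]
      congr 2
      norm_num
    rw [e, show (1 : ℝ) / 4 = 4⁻¹ by norm_num]
    exact inv_strictAnti₀ (by norm_num) four_lt_exp_half_mul_sqrt_two_pi
  have hlog : 1 - (s : ℝ) / p ≤ ℓ := by
    have := Real.one_sub_inv_le_log_of_pos (show 0 < (p : ℝ) / s by positivity)
    rwa [inv_div] at this
  have hbound : ((p : ℝ) - s) * thresholdMoment √(2 * ℓ) < s / 4 := by
    calc ((p : ℝ) - s) * thresholdMoment √(2 * ℓ)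
        ≤ ((p : ℝ) - s) * (2 * ((√(2 * Real.pi))⁻¹ * (s / p) * Real.exp (-1 / 2)) * (2 * ℓ)⁻¹) :=
          mul_le_mul_of_nonneg_left hth (by linarith)
      _ = c * s * ((1 - (s : ℝ) / p) / ℓ) := by rw [hc]; field_simp
      _ ≤ c * s * 1 := by
          gcongr
          rwa [div_le_one hℓ0]
      _ < s / 4 := by nlinarith
  rw [ht2] at h
  linarith

end WidthBound

/-! ### Recovery by `ℓ₁` minimization -/

theorem proposition3p9 {p s : ℕ} (hsp : s ≤ p) (x : EuclideanSpace ℝ (Fin p)) (hx : x ≠ 0)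
    (hs : IsSparse s x) :
    Integrable (supInner (sphericalTangent (sparseAtoms p) x))
        (stdGaussian (EuclideanSpace ℝ (Fin p))) ∧
    gaussianWidth (sphericalTangent (sparseAtoms p) x) ^ 2
        ≤ 2 * (s : ℝ) * Real.log ((p : ℝ) / (s : ℝ)) + 5 / 4 * (s : ℝ) ∧
    ∀ n : ℕ, 2 * (s : ℝ) * Real.log ((p : ℝ) / (s : ℝ)) + 5 / 4 * (s : ℝ) + 1 ≤ (n : ℝ) →
      gaussianWidth (sphericalTangent (sparseAtoms p) x) < expectedGaussianLength n ∧
      ∀ {Ω : Type*} [MeasurableSpace Ω] (P : Measure Ω) [IsProbabilityMeasure P]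
        (Φ : Ω → Matrix (Fin n) (Fin p) ℝ), IsGaussianMap P Φ →
        1 - Real.exp (-(1 / 2) *
            (expectedGaussianLength n
              - gaussianWidth (sphericalTangent (sparseAtoms p) x)) ^ 2)
          ≤ P.real {ω | IsUniqueOptimum l1Norm (Φ ω) ((Φ ω).mulVec x.ofLp) x} := by
  have hs0 : 0 < s := by
    obtain ⟨i, hi⟩ : ∃ i, x i ≠ 0 := by
      by_contra! h
      exact hx (by ext i; simpa using h i)
    exact ((Set.ncard_pos (Set.toFinite _)).2 ⟨i, hi⟩).trans_le hs
  have hsub := sphericalTangent_subset_sphere (x := x) (sparseAtoms p)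
  have hne := sphericalTangent_nonempty hx
  have hlt := gaussianWidth_sq_lt hsp hs0 hx hs
  refine ⟨integrable_supInner hsub hne, hlt.le, fun n hn => ?_⟩
  have hw : gaussianWidth (sphericalTangent (sparseAtoms p) x) < expectedGaussianLength n := by
    refine lt_of_pow_lt_pow_left₀ 2 (expectedGaussianLength_nonneg n) ?_
    linarith [sub_one_le_expectedGaussianLength_sq n]
  refine ⟨hw, fun P _ Φ hΦ => ?_⟩
  have hn0 : 0 < n := by
    have h1 : (0 : ℝ) < n := by
      linarith [sq_nonneg (gaussianWidth (sphericalTangent (sparseAtoms p) x))]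
    exact_mod_cast h1
  have hbad := hΦ.measureReal_exists_mulVec_eq_zero_le hn0 hsub hne hw
  -- Only subadditivity is used, so measurability of the recovery event is not needed.
  set A := {ω | IsUniqueOptimum l1Norm (Φ ω) ((Φ ω).mulVec x.ofLp) x} with hA
  have hcompl : P.real Aᶜ
      ≤ P.real {ω | ∃ z ∈ sphericalTangent (sparseAtoms p) x, (Φ ω).mulVec z.ofLp = 0} :=
    measureReal_mono fun ω hω => exists_mem_sphericalTangent_of_not_isUniqueOptimum hω
  have hunion := measureReal_union_le (μ := P) A Aᶜ
  rw [Set.union_compl_self, probReal_univ] at hunion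
  linarith
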